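/- Let $\gamma\in[-3,-2)$ and consider the Krieger--Strain equation on $\mathbb R^3$, $$\partial_t f=a[f]\,\Delta f-(2+\gamma)\,h[f]\,f,\qquad a[f]=f*|\cdot|^{2+\gamma},\qquad h[f]=\begin{cases}(3+\gamma)\,f*|\cdot|^{\gamma}&\gamma\in(-3,-2),\\ 4\pi f&\gamma=-3.\end{cases}$$ By a classical solution on $[0,T]$, $0<T<\infty$, we mean $f:[0,T]\times\mathbb R^3\to[0,\infty)$ with $f(t)\in L^1(\mathbb R^3)$ for every $t\in[0,T]$ and $\sup_{t\in[0,T]}\|f(t)\|_{L^1}<\infty$, such that $f$, $\partial_t f$, $D_vf$, $D^2_vf$ exist and are continuous on $(0,T]\times\mathbb R^3$, the equation holds pointwise there, and the initial datum $f_{\rm in}=f(0)$ is attained weakly: $\int f(t)\varphi\,dv\to\int f_{\rm in}\varphi\,dv$ as $t\to0^+$ for every $\varphi\in C_c(\mathbb R^3)$. For $s\ge0$ and $g\ge 0$ put $E_s(g)=\int_{\mathbb R^3}g(v)|v|^s\,dv\in[0,\infty]$, and write $x_+=\max(x,0)$. Proposition. For every $\gamma\in[-3,-2)$ and $s\ge0$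 the following holds. Let $f$ be a classical solution on $[0,T]$ with $\|f\|_{L^\infty([0,T];L^3(\mathbb R^3))}<\infty$ and $E_s(f_{\rm in})<\infty$. Then, for all $t\in[0,T]$, $$E_s(f(t))\le C\Big(E_{\max(s,2)}(f_{\rm in})\,\max(1,t)^{(s-2)_+/2}+t^{s/2}\Big),$$ where $C>0$ depends only on $s$, $\gamma$, $\|f_{\rm in}\|_{L^1}$ and $\|f\|_{L^\infty([0,T];L^3)}$ (in particular not on $T$); the right-hand side is $+\infty$ if $E_{\max(s,2)}(f_{\rm in})=\infty$, and $t^{s/2}=1$ for $s=0$, including at $t=0$. For $s\ge2$ this reads $$E_s(f(t))\le C\Big(E_s(f_{\rm in})\,\max(1,t)^{(s-2)/2}+t^{s/2}\Big).$$ Moreover $\sup_{t\in[0,T]}E_s(f(t))<\infty$: every moment that is finite initially stays bounded on finite time intervals. -/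

import Mathlib

open Set Filter Topology MeasureTheory
open scoped ENNReal NNReal InnerProductSpace

namespace KriegerStrain

/-- The velocity space `ℝ³` with its Euclidean norm and Lebesgue measure. -/
abbrev V : Type := EuclideanSpace ℝ (Fin 3)

/-- The diffusion coefficient `a[g](v) = (g ∗ |·|^(2+γ))(v)`. -/
noncomputable def diffusionCoeff (γ : ℝ) (g : V → ℝ) (v : V) : ℝ :=
  ∫ w, g w * ‖v - w‖ ^ (2 + γ)

open Classical in
/-- The reaction coefficient: `h[g] = (3+γ) g ∗ |·|^γ` for `γ ≠ -3`, and `h[g] = 4π g` in the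
Coulomb case `γ = -3`. -/
noncomputable def reactionCoeff (γ : ℝ) (g : V → ℝ) (v : V) : ℝ :=
  if γ = -3 then 4 * Real.pi * g v else (3 + γ) * ∫ w, g w * ‖v - w‖ ^ γ

/-- The right-hand side `a[g] Δg - (2+γ) h[g] g` of the Krieger-Strain equation. -/
noncomputable def collision (γ : ℝ) (g : V → ℝ) (v : V) : ℝ :=
  diffusionCoeff γ g v * Laplacian.laplacian g v - (2 + γ) * reactionCoeff γ g v * g v

/-- The moment `E_s(g) = ∫ g(v) |v|^s dv ∈ [0,∞]` of a nonnegative function `g`. -/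
noncomputable def moment (s : ℝ) (g : V → ℝ) : ℝ≥0∞ :=
  ∫⁻ v, ENNReal.ofReal (g v * ‖v‖ ^ s)

/-- The norm of `f` in `L^∞([0,T]; L³(ℝ³))`, with values in `[0,∞]`. -/
noncomputable def normLinftyL3 (T : ℝ) (f : ℝ → V → ℝ) : ℝ≥0∞ :=
  essSup (fun t => eLpNorm (f t) 3 volume) (volume.restrict (Icc 0 T))

/-- A nonnegative classical solution `f : [0,T] × ℝ³ → [0,∞)` of the Krieger-Strain equation
`∂ₜ f = a[f] Δf - (2+γ) h[f] f` with initial datum `f 0`: `f` is bounded in `L¹` on `[0,T]`, is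
`C¹` in time and `C²` in velocity on `(0,T] × ℝ³`, satisfies the equation pointwise there, and
attains its initial datum weakly, i.e. against continuous compactly supported functions. (If `f`
is continuous on `[0,T] × ℝ³`, the last condition holds automatically.)
No decay in `v` beyond integrability is required. -/
structure IsClassicalSolution (γ T : ℝ) (f : ℝ → V → ℝ) : Prop where
  nonneg : ∀ t ∈ Icc 0 T, ∀ v, 0 ≤ f t v
  integrable : ∀ t ∈ Icc 0 T, Integrable (f t) volume
  bounded_mass : ∃ M : ℝ, ∀ t ∈ Icc 0 T, ∫ v, f t v ≤ M
  contDiff : ∀ t ∈ Ioc 0 T, ContDiff ℝ 2 (f t)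
  continuousOn_space : ∀ k : ℕ, k ≤ 2 →
    ContinuousOn (fun p : ℝ × V => iteratedFDeriv ℝ k (f p.1) p.2) (Ioc 0 T ×ˢ univ)
  continuousOn_time :
    ContinuousOn (fun p : ℝ × V => derivWithin (fun τ => f τ p.2) (Ioc 0 T) p.1)
      (Ioc 0 T ×ˢ univ)
  equation : ∀ t ∈ Ioc 0 T, ∀ v,
    HasDerivWithinAt (fun τ => f τ v) (collision γ (f t) v) (Ioc 0 T) t
  initial : ∀ φ : V → ℝ, Continuous φ → HasCompactSupport φ →
    Tendsto (fun t => ∫ v, f t v * φ v) (𝓝[>] 0) (𝓝 (∫ v, f 0 v * φ v))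

end KriegerStrain

/-! Put p = 2 + γ ∈ [-1, 0) and K = |·|^p. On ℝ³, Δ|z|^p = p(1+p)|z|^(p-2), and Δ|z|^(-1) = -4πδ, so
(2+γ) h[f] = Δa[f] and the equation reads ∂ₜf = a Δf - f Δa. Its weak form is d/dt ∫ fφ = ∬ f(v)
f(w) [K(v-w) Δφ(v) + 2 ∇K(v-w)·∇φ(v)]. Symmetrizing in v and w turns ∇φ(v) into half of ∇φ(v) -
∇φ(w), and the factor |v-w| so gained compensates the extra singularity of ∇K. If L controls the
Hessian of φ, what remains is at most 5 ∫ a[f] f L, with no derivative of f left. To justify this, K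
is replaced by (|z|²+ε)^(p/2) and ε tends to 0 at the end (`integral_weakDensity_le`,
`integral_mul_collision_le`). The coefficient a[f] is bounded by mass and L³ norm (`diffusion_le`).

The weight (1+|v|²)^σ has Hessian of order (1+|v|²)^((σ-1)₊), uniformly under truncation. Hence the
moment of order σ grows at most linearly in time, at a rate given by the moment of order (σ-1)₊
(`exists_smoothMoment_step`). Starting from the mass, which cannot increase, induction in unit steps
of σ gives J_σ(t) ≲ J_σ(0) Λ^(σ-1) + m Λ^σ for t ≤ Λ and σ ≥ 1, where J_σ is the smooth moment and m
the initial mass. For σ ≤ 1 one interpolates between orders 0 and 1 (`exists_smoothMoment_growth`).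

With Λ = max(1,t), the term m Λ^σ leaves a constant m at small times that t^(s/2) does not cover. It
is absorbed by the initial moment: the L³ bound passes through the weak initial condition and
prevents the datum from concentrating at the origin, so that m ≤ D E_r(f_in)
(`exists_mass_le_moment`). -/

namespace KriegerStrain

/-! ### Laplacians, Green's identity and radial functions -/

section Calculus

theorem hasFDerivAt_radial {E : Type*} [NormedAddCommGroup E] [InnerProductSpace ℝ E]
    {H H' : ℝ → ℝ} (hH : ∀ x, 0 ≤ x → HasDerivAt H (H' x) x) (c v : E) :
    HasFDerivAt (fun v => H (‖v - c‖ ^ 2))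
      ((2 * H' (‖v - c‖ ^ 2)) • innerSL ℝ (v - c)) v := by
  have h1 : HasFDerivAt (fun v : E => ‖v - c‖ ^ 2) (2 • innerSL ℝ (v - c)) v := by
    have := ((hasFDerivAt_id (𝕜 := ℝ) v).sub_const c).norm_sq
    simpa using this
  have := (hH _ (sq_nonneg ‖v - c‖)).comp_hasFDerivAt v h1
  have e : (2 * H' (‖v - c‖ ^ 2)) • innerSL ℝ (v - c) =
      H' (‖v - c‖ ^ 2) • 2 • innerSL ℝ (v - c) := by module
  rw [e]
  exact this

variable {E : Type*} [NormedAddCommGroup E] [InnerProductSpace ℝ E] [FiniteDimensional ℝ E]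
  {ι : Type*} [Fintype ι]

theorem laplacian_eq_sum_fderiv (b : OrthonormalBasis ι ℝ E) {f : E → ℝ} (hf : ContDiff ℝ 2 f)
    (v : E) :
    Laplacian.laplacian f v = ∑ i, fderiv ℝ (fun x => fderiv ℝ f x (b i)) v (b i) := by
  have h1 : Differentiable ℝ (fderiv ℝ f) :=
    (hf.fderiv_right (m := 1) (by norm_num)).differentiable (by norm_num)
  rw [InnerProductSpace.laplacian_eq_iteratedFDeriv_orthonormalBasis f b]
  refine Finset.sum_congr rfl fun i _ => ?_
  rw [iteratedFDeriv_two_apply, fderiv_clm_apply (h1 v) (by fun_prop)]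
  simp

theorem continuous_laplacian {f : E → ℝ} (hf : ContDiff ℝ 2 f) :
    Continuous (Laplacian.laplacian f) := by
  have h : Laplacian.laplacian f = _ :=
    funext fun v => laplacian_eq_sum_fderiv (stdOrthonormalBasis ℝ E) hf v
  rw [h]
  refine continuous_finsetSum _ fun i _ => ?_
  have h2 : ContDiff ℝ 1 (fun x => fderiv ℝ f x (stdOrthonormalBasis ℝ E i)) :=
    (hf.fderiv_right (m := 1) (by norm_num)).clm_apply contDiff_const
  exact (h2.continuous_fderiv (by norm_num)).clm_apply continuous_const

theorem laplacian_mul (b : OrthonormalBasis ι ℝ E) {f g : E → ℝ} (hf : ContDiff ℝ 2 f)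
    (hg : ContDiff ℝ 2 g) (v : E) :
    Laplacian.laplacian (fun x => f x * g x) v =
      f v * Laplacian.laplacian g v + g v * Laplacian.laplacian f v
        + 2 * ∑ i, fderiv ℝ f v (b i) * fderiv ℝ g v (b i) := by
  rw [laplacian_eq_sum_fderiv b (hf.mul hg), laplacian_eq_sum_fderiv b hf,
    laplacian_eq_sum_fderiv b hg, Finset.mul_sum, Finset.mul_sum, Finset.mul_sum,
    ← Finset.sum_add_distrib, ← Finset.sum_add_distrib]
  refine Finset.sum_congr rfl fun i _ => ?_
  have df : Differentiable ℝ f := hf.differentiable (by norm_num)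
  have dg : Differentiable ℝ g := hg.differentiable (by norm_num)
  have d2 : ∀ {u : E → ℝ}, ContDiff ℝ 2 u → Differentiable ℝ (fun x => fderiv ℝ u x (b i)) :=
    fun hu => ((hu.fderiv_right (m := 1) (by norm_num)).clm_apply
      contDiff_const).differentiable (by norm_num)
  have h1 : (fun x => fderiv ℝ (fun y => f y * g y) x (b i)) =
      fun x => f x * fderiv ℝ g x (b i) + g x * fderiv ℝ f x (b i) := by
    funext x
    rw [fderiv_fun_mul (df x) (dg x)]
    simp
  rw [h1, fderiv_fun_add ((df v).fun_mul (d2 hg v)) ((dg v).fun_mul (d2 hf v)),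
    fderiv_fun_mul (df v) (d2 hg v), fderiv_fun_mul (dg v) (d2 hf v)]
  simp
  ring

/-- Compact support of one factor makes every product in the two integrations by parts integrable,
so the solution can play the role of `g` without any decay of its derivatives. -/
theorem integral_mul_laplacian [MeasurableSpace E] [BorelSpace E] {f g : E → ℝ}
    (hf : ContDiff ℝ 2 f) (hc : HasCompactSupport f) (hg : ContDiff ℝ 2 g) :
    ∫ v, f v * Laplacian.laplacian g v = ∫ v, Laplacian.laplacian f v * g v := by
  set b := stdOrthonormalBasis ℝ E
  have df : Differentiable ℝ f := hf.differentiable (by norm_num)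
  have dg : Differentiable ℝ g := hg.differentiable (by norm_num)
  have c1 : ∀ {u : E → ℝ}, ContDiff ℝ 2 u → ∀ i, ContDiff ℝ 1 (fun x => fderiv ℝ u x (b i)) :=
    fun hu i => (hu.fderiv_right (m := 1) (by norm_num)).clm_apply contDiff_const
  have c2 : ∀ {u : E → ℝ}, ContDiff ℝ 2 u → ∀ i, Continuous
      (fun x => fderiv ℝ (fun y => fderiv ℝ u y (b i)) x (b i)) :=
    fun hu i => ((c1 hu i).continuous_fderiv (by norm_num)).clm_apply continuous_const
  have s1 : ∀ {u : E → ℝ}, HasCompactSupport u → ∀ i, HasCompactSupport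
      (fun x => fderiv ℝ u x (b i)) := fun hu i => hu.fderiv_apply ℝ (b i)
  have I1 : ∀ i, Integrable fun x => f x * fderiv ℝ (fun y => fderiv ℝ g y (b i)) x (b i) :=
    fun i => (hf.continuous.mul (c2 hg i)).integrable_of_hasCompactSupport hc.mul_right
  have I2 : ∀ i, Integrable fun x => fderiv ℝ (fun y => fderiv ℝ f y (b i)) x (b i) * g x :=
    fun i => ((c2 hf i).mul hg.continuous).integrable_of_hasCompactSupport
      (s1 (s1 hc i) i).mul_right
  have I3 : ∀ i, Integrable fun x => fderiv ℝ f x (b i) * fderiv ℝ g x (b i) :=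
    fun i => ((c1 hf i).continuous.mul (c1 hg i).continuous).integrable_of_hasCompactSupport
      (s1 hc i).mul_right
  have I4 : ∀ i, Integrable fun x => f x * fderiv ℝ g x (b i) :=
    fun i => (hf.continuous.mul (c1 hg i).continuous).integrable_of_hasCompactSupport hc.mul_right
  have I5 : ∀ i, Integrable fun x => fderiv ℝ f x (b i) * g x :=
    fun i => ((c1 hf i).continuous.mul hg.continuous).integrable_of_hasCompactSupport
      (s1 hc i).mul_right
  simp_rw [laplacian_eq_sum_fderiv b hf, laplacian_eq_sum_fderiv b hg, Finset.mul_sum,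
    Finset.sum_mul]
  rw [integral_finsetSum _ fun i _ => I1 i, integral_finsetSum _ fun i _ => I2 i]
  refine Finset.sum_congr rfl fun i _ => ?_
  have d1 : ∀ {u : E → ℝ}, ContDiff ℝ 2 u → Differentiable ℝ (fun x => fderiv ℝ u x (b i)) :=
    fun hu => (c1 hu i).differentiable (by norm_num)
  rw [integral_mul_fderiv_eq_neg_fderiv_mul_of_integrable (I3 i) (I1 i) (I4 i)
      (fun x _ => df x) (fun x _ => d1 hg x),
    integral_mul_fderiv_eq_neg_fderiv_mul_of_integrable (I2 i) (I3 i) (I5 i)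
      (fun x _ => d1 hf x) (fun x _ => dg x), neg_neg]

theorem laplacian_radial (b : OrthonormalBasis ι ℝ E) {H H' H'' : ℝ → ℝ}
    (hH : ∀ x, 0 ≤ x → HasDerivAt H (H' x) x) (hH' : ∀ x, 0 ≤ x → HasDerivAt H' (H'' x) x)
    (c : E) (hC : ContDiff ℝ 2 (fun v : E => H (‖v - c‖ ^ 2))) (v : E) :
    Laplacian.laplacian (fun v => H (‖v - c‖ ^ 2)) v =
      2 * Fintype.card ι * H' (‖v - c‖ ^ 2) + 4 * ‖v - c‖ ^ 2 * H'' (‖v - c‖ ^ 2) := by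
  rw [laplacian_eq_sum_fderiv b hC]
  have h1 : ∀ i, (fun x => fderiv ℝ (fun v => H (‖v - c‖ ^ 2)) x (b i)) =
      fun x => 2 * H' (‖x - c‖ ^ 2) * ⟪x - c, b i⟫_ℝ := by
    intro i
    funext x
    rw [(hasFDerivAt_radial hH c x).fderiv]
    rfl
  have h2 : ∀ i, fderiv ℝ (fun x => 2 * H' (‖x - c‖ ^ 2) * ⟪x - c, b i⟫_ℝ) v (b i) =
      2 * H' (‖v - c‖ ^ 2) + 4 * H'' (‖v - c‖ ^ 2) * ⟪b i, v - c⟫_ℝ ^ 2 := by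
    intro i
    have e1 := ((hasFDerivAt_radial hH' c v).const_mul 2)
    have e2 : HasFDerivAt (fun x : E => ⟪x - c, b i⟫_ℝ) (innerSL ℝ (b i)) v := by
      have := ((innerSL ℝ (b i)).hasFDerivAt (x := v - c)).comp v
        ((hasFDerivAt_id (𝕜 := ℝ) v).sub_const c)
      have e : (fun x : E => ⟪x - c, b i⟫_ℝ) = innerSL ℝ (b i) ∘ fun x => id x - c := by
        funext x
        exact real_inner_comm _ _
      rw [e]
      exact this
    rw [(e1.fun_mul e2).fderiv]
    simp only [add_apply, smul_apply, innerSL_apply_apply,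
      smul_eq_mul, real_inner_comm (b i) (v - c), real_inner_self_eq_norm_sq, b.norm_eq_one]
    ring
  simp_rw [h1, h2]
  rw [Finset.sum_add_distrib, ← Finset.mul_sum Finset.univ (fun i => ⟪b i, v - c⟫_ℝ ^ 2),
    b.sum_sq_inner_right, Finset.sum_const,
    Finset.card_univ, nsmul_eq_mul]
  ring

end Calculus

/-! ### The regularized kernel and its Laplacian -/

/-- The regularization `(|z|² + ε)^(p/2)` of the kernel `|z|^p`. -/
noncomputable def regKernel (p ε : ℝ) (z : V) : ℝ := (‖z‖ ^ 2 + ε) ^ (p / 2)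

/-- The derivative of `x ↦ (x + ε)^(p/2)` at `x = |z|²`. -/
noncomputable def regKernelDeriv (p ε : ℝ) (z : V) : ℝ := p / 2 * (‖z‖ ^ 2 + ε) ^ (p / 2 - 1)

/-- Minus the Laplacian of `regKernel p ε`. -/
noncomputable def regSource (p ε : ℝ) (z : V) : ℝ :=
  -p * (‖z‖ ^ 2 + ε) ^ (p / 2 - 2) * ((1 + p) * ‖z‖ ^ 2 + 3 * ε)

section Kernel

variable {p ε : ℝ}

theorem norm_sq_add_pos (hε : 0 < ε) (z : V) : 0 < ‖z‖ ^ 2 + ε := by positivity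

theorem contDiff_regKernel (hε : 0 < ε) : ContDiff ℝ 2 (regKernel p ε) :=
  ((contDiff_norm_sq ℝ).add contDiff_const).rpow_const_of_ne
    fun z => (norm_sq_add_pos hε z).ne'

theorem continuous_regKernel (hε : 0 < ε) : Continuous (regKernel p ε) :=
  (contDiff_regKernel hε).continuous

theorem continuous_regKernelDeriv (hε : 0 < ε) : Continuous (regKernelDeriv p ε) :=
  continuous_const.mul (Continuous.rpow_const (by fun_prop)
    fun z => Or.inl (norm_sq_add_pos hε z).ne')

theorem continuous_regSource (hε : 0 < ε) : Continuous (regSource p ε) :=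
  (continuous_const.mul (Continuous.rpow_const (by fun_prop)
    fun z => Or.inl (norm_sq_add_pos hε z).ne')).mul (by fun_prop)

theorem regKernel_nonneg (hε : 0 < ε) (z : V) : 0 ≤ regKernel p ε z :=
  Real.rpow_nonneg (norm_sq_add_pos hε z).le _

theorem regKernel_le (hp : p < 0) (hε : 0 < ε) (z : V) : regKernel p ε z ≤ ε ^ (p / 2) :=
  Real.rpow_le_rpow_of_nonpos hε (by nlinarith [sq_nonneg ‖z‖]) (by linarith)

theorem regKernel_le_rpow (hp : p < 0) (hε : 0 < ε) {z : V} (hz : z ≠ 0) :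
    regKernel p ε z ≤ ‖z‖ ^ p := by
  have h : 0 < ‖z‖ := norm_pos_iff.2 hz
  calc regKernel p ε z ≤ (‖z‖ ^ 2) ^ (p / 2) :=
        Real.rpow_le_rpow_of_nonpos (by positivity) (by linarith) (by linarith)
    _ = ‖z‖ ^ p := by
        rw [← Real.rpow_natCast, ← Real.rpow_mul h.le]
        congr 1
        push_cast
        ring

/-- Powers |z|^p with -1 ≤ p < 0 are superharmonic on ℝ³, and the regularization keeps this; the
sign needs 1 + p ≥ 0, that is γ ≥ -3. -/
theorem regSource_nonneg (hp1 : -1 ≤ p) (hp : p < 0) (hε : 0 < ε) (z : V) :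
    0 ≤ regSource p ε z := by
  have h := Real.rpow_nonneg (norm_sq_add_pos hε z).le (p / 2 - 2)
  have h1 : 0 ≤ (1 + p) * ‖z‖ ^ 2 := mul_nonneg (by linarith) (sq_nonneg _)
  exact mul_nonneg (mul_nonneg (by linarith) h) (by linarith)

theorem regSource_le (hp1 : -1 ≤ p) (hp : p < 0) (hε : 0 < ε) (z : V) :
    regSource p ε z ≤ 3 * (‖z‖ ^ 2 + ε) ^ (p / 2 - 1) := by
  have hx := norm_sq_add_pos hε z
  have h := Real.rpow_nonneg hx.le (p / 2 - 2)
  have e : (‖z‖ ^ 2 + ε) ^ (p / 2 - 1) = (‖z‖ ^ 2 + ε) ^ (p / 2 - 2) * (‖z‖ ^ 2 + ε) := by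
    rw [← Real.rpow_add_one hx.ne']
    congr 1
    ring
  have h2 : (1 + p) * ‖z‖ ^ 2 + 3 * ε ≤ 3 * (‖z‖ ^ 2 + ε) := by nlinarith [sq_nonneg ‖z‖]
  have h1 : 0 ≤ (1 + p) * ‖z‖ ^ 2 := mul_nonneg (by linarith) (sq_nonneg _)
  rw [e, regSource]
  calc -p * (‖z‖ ^ 2 + ε) ^ (p / 2 - 2) * ((1 + p) * ‖z‖ ^ 2 + 3 * ε)
      ≤ 1 * (‖z‖ ^ 2 + ε) ^ (p / 2 - 2) * (3 * (‖z‖ ^ 2 + ε)) := by gcongr; linarith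
    _ = _ := by ring

theorem regSource_le_const (hp1 : -1 ≤ p) (hp : p < 0) (hε : 0 < ε) (z : V) :
    regSource p ε z ≤ 3 * ε ^ (p / 2 - 1) := by
  refine (regSource_le hp1 hp hε z).trans (mul_le_mul_of_nonneg_left ?_ (by norm_num))
  exact Real.rpow_le_rpow_of_nonpos hε (by nlinarith [sq_nonneg ‖z‖]) (by linarith)

/-- The cancellation estimate: z·∇K_ε is no more singular than K_ε, uniformly in ε. The factor 1/2
is the bound on |p|/2. -/
theorem abs_regKernelDeriv_mul_sq_le (hp1 : -1 ≤ p) (hp : p < 0) (hε : 0 < ε) (z : V) :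
    |regKernelDeriv p ε z| * ‖z‖ ^ 2 ≤ regKernel p ε z / 2 := by
  have hx := norm_sq_add_pos hε z
  have h := Real.rpow_nonneg hx.le (p / 2 - 1)
  have e : regKernel p ε z = (‖z‖ ^ 2 + ε) ^ (p / 2 - 1) * (‖z‖ ^ 2 + ε) := by
    rw [← Real.rpow_add_one hx.ne', regKernel]
    congr 1
    ring
  rw [e, regKernelDeriv, abs_mul, abs_of_nonneg h, abs_of_neg (by linarith : p / 2 < 0)]
  calc -(p / 2) * (‖z‖ ^ 2 + ε) ^ (p / 2 - 1) * ‖z‖ ^ 2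
      ≤ 1 / 2 * (‖z‖ ^ 2 + ε) ^ (p / 2 - 1) * (‖z‖ ^ 2 + ε) := by gcongr <;> linarith
    _ = _ := by ring

/-- This bound degenerates as ε → 0 and serves only to make the bilinear density bounded for fixed
ε, so that Fubini applies. -/
theorem abs_regKernelDeriv_mul_le (hp1 : -1 ≤ p) (hp : p < 0) (hε : 0 < ε) (z : V) :
    |regKernelDeriv p ε z| * ‖z‖ ≤ ε ^ (p / 2 - 1) + ε ^ (p / 2) := by
  have hx := norm_sq_add_pos hε z
  have h0 : |regKernelDeriv p ε z| ≤ ε ^ (p / 2 - 1) := by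
    have h := Real.rpow_nonneg hx.le (p / 2 - 1)
    rw [regKernelDeriv, abs_mul, abs_of_nonneg h, abs_of_neg (by linarith : p / 2 < 0)]
    calc -(p / 2) * (‖z‖ ^ 2 + ε) ^ (p / 2 - 1) ≤ 1 * (‖z‖ ^ 2 + ε) ^ (p / 2 - 1) := by
          gcongr
          linarith
      _ ≤ ε ^ (p / 2 - 1) := by
          rw [one_mul]
          exact Real.rpow_le_rpow_of_nonpos hε (by nlinarith [sq_nonneg ‖z‖]) (by linarith)
  have h1 := abs_regKernelDeriv_mul_sq_le hp1 hp hε z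
  have h2 := regKernel_le hp hε z
  have h3 := regKernel_nonneg (p := p) hε z
  have h4 : ‖z‖ ≤ 1 + ‖z‖ ^ 2 := by nlinarith [sq_nonneg (‖z‖ - 1), norm_nonneg z]
  nlinarith [abs_nonneg (regKernelDeriv p ε z)]

theorem hasDerivAt_rpow_add (hε : 0 < ε) (q : ℝ) {x : ℝ} (hx : 0 ≤ x) :
    HasDerivAt (fun x => (x + ε) ^ q) (q * (x + ε) ^ (q - 1)) x := by
  have := ((hasDerivAt_id x).add_const ε).rpow_const (p := q) (Or.inl (by positivity))
  simpa using this

theorem fderiv_regKernel (hε : 0 < ε) (w v h : V) :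
    fderiv ℝ (fun v => regKernel p ε (v - w)) v h =
      2 * regKernelDeriv p ε (v - w) * ⟪v - w, h⟫_ℝ := by
  have := hasFDerivAt_radial (fun x hx => hasDerivAt_rpow_add hε (p / 2) hx) w v
  have e := this.fderiv
  unfold regKernel
  rw [e]
  rfl

theorem laplacian_regKernel (hε : 0 < ε) (w v : V) :
    Laplacian.laplacian (fun v => regKernel p ε (v - w)) v = -regSource p ε (v - w) := by
  have hC : ContDiff ℝ 2 (fun v => regKernel p ε (v - w)) :=
    (contDiff_regKernel hε).comp (contDiff_id.sub contDiff_const)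
  unfold regKernel at hC ⊢
  have := laplacian_radial (H := fun x => (x + ε) ^ (p / 2))
    (H' := fun x => p / 2 * (x + ε) ^ (p / 2 - 1))
    (H'' := fun x => p / 2 * ((p / 2 - 1) * (x + ε) ^ (p / 2 - 1 - 1)))
    (EuclideanSpace.basisFun (Fin 3) ℝ)
    (fun x hx => hasDerivAt_rpow_add hε (p / 2) hx)
    (fun x hx => (hasDerivAt_rpow_add hε (p / 2 - 1) hx).const_mul _) w hC v
  rw [this, regSource]
  have hx := norm_sq_add_pos hε (v - w)
  have e : (‖v - w‖ ^ 2 + ε) ^ (p / 2 - 1) =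
      (‖v - w‖ ^ 2 + ε) ^ (p / 2 - 2) * (‖v - w‖ ^ 2 + ε) := by
    rw [← Real.rpow_add_one hx.ne']
    congr 1
    ring
  have e2 : p / 2 - 1 - 1 = p / 2 - 2 := by ring
  rw [e2, e]
  simp
  ring

theorem hasCompactSupport_laplacian {φ : V → ℝ} (hc : HasCompactSupport φ) :
    HasCompactSupport (Laplacian.laplacian φ) := by
  refine HasCompactSupport.intro hc fun v hv => ?_
  rw [InnerProductSpace.laplacian_congr_nhds (notMem_tsupport_iff_eventuallyEq.1 hv) |>.eq_of_nhds]
  exact congrFun InnerProductSpace.laplacian_const v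

/-- Green's identity moves Δ onto φK_ε, and Δ(φK_ε) = K_ε Δφ + 2 ∇φ·∇K_ε + φ ΔK_ε. Since ΔK_ε = -S_ε
with S_ε the regularized source, the reaction term cancels the last summand. -/
theorem integral_regKernel_green (hε : 0 < ε) {φ g : V → ℝ} (hφ : ContDiff ℝ 2 φ)
    (hc : HasCompactSupport φ) (hg : ContDiff ℝ 2 g) (w : V) :
    ∫ v, (φ v * Laplacian.laplacian g v * regKernel p ε (v - w) +
        φ v * g v * regSource p ε (v - w)) =
      ∫ v, g v * (regKernel p ε (v - w) * Laplacian.laplacian φ v +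
        4 * (regKernelDeriv p ε (v - w) * fderiv ℝ φ v (v - w))) := by
  have hK : ContDiff ℝ 2 (fun v => regKernel p ε (v - w)) :=
    (contDiff_regKernel hε).comp (contDiff_id.sub contDiff_const)
  have hS : Continuous (fun v => regSource p ε (v - w)) :=
    (continuous_regSource hε).comp (by fun_prop)
  have hψ := hφ.mul hK
  have hψc : HasCompactSupport (fun v => φ v * regKernel p ε (v - w)) := hc.mul_right
  have hI : Integrable (fun v => φ v * g v * regSource p ε (v - w)) :=
    ((hφ.continuous.mul hg.continuous).mul hS).integrable_of_hasCompactSupport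
      (hc.mul_right).mul_right
  have hI2 : Integrable (fun v => φ v * Laplacian.laplacian g v * regKernel p ε (v - w)) :=
    ((hφ.continuous.mul (continuous_laplacian hg)).mul
      hK.continuous).integrable_of_hasCompactSupport (hc.mul_right).mul_right
  have hlap : ∀ v, Laplacian.laplacian (fun v => φ v * regKernel p ε (v - w)) v =
      regKernel p ε (v - w) * Laplacian.laplacian φ v +
        4 * (regKernelDeriv p ε (v - w) * fderiv ℝ φ v (v - w)) - φ v * regSource p ε (v - w) := by
    intro v
    rw [laplacian_mul (EuclideanSpace.basisFun (Fin 3) ℝ) hφ hK, laplacian_regKernel hε]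
    have e : ∑ i, fderiv ℝ φ v (EuclideanSpace.basisFun (Fin 3) ℝ i) *
        fderiv ℝ (fun v => regKernel p ε (v - w)) v (EuclideanSpace.basisFun (Fin 3) ℝ i) =
        2 * (regKernelDeriv p ε (v - w) * fderiv ℝ φ v (v - w)) := by
      have e0 := congrArg (fderiv ℝ φ v) ((EuclideanSpace.basisFun (Fin 3) ℝ).sum_repr' (v - w))
      rw [← e0, map_sum, Finset.mul_sum, Finset.mul_sum]
      refine Finset.sum_congr rfl fun i _ => ?_
      rw [fderiv_regKernel hε, map_smul, smul_eq_mul, real_inner_comm]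
      ring
    rw [e]
    ring
  have key := integral_mul_laplacian hψ hψc hg
  simp_rw [hlap] at key
  have hI3 : Integrable fun v => (regKernel p ε (v - w) * Laplacian.laplacian φ v +
      4 * (regKernelDeriv p ε (v - w) * fderiv ℝ φ v (v - w)) - φ v * regSource p ε (v - w)) *
        g v := by
    have : Integrable fun v =>
        Laplacian.laplacian (fun v => φ v * regKernel p ε (v - w)) v * g v := by
      exact ((continuous_laplacian hψ).mul hg.continuous).integrable_of_hasCompactSupport
        (hasCompactSupport_laplacian hψc).mul_right
    simpa only [hlap] using this
  rw [integral_add hI2 hI]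
  have e1 : ∫ v, φ v * Laplacian.laplacian g v * regKernel p ε (v - w) =
      ∫ v, φ v * regKernel p ε (v - w) * Laplacian.laplacian g v :=
    integral_congr_ae (ae_of_all _ fun v => by ring)
  rw [e1, key, ← integral_add hI3 hI]
  exact integral_congr_ae (ae_of_all _ fun v => by ring)

end Kernel

/-! ### The regularized bilinear form and its symmetrization -/

section Regularized

variable {p ε : ℝ}

theorem integrable_prod_mul_bdd {f g : V → ℝ} (hf : Integrable f) (hg : Integrable g)
    {u : V × V → ℝ} (hu : Continuous u) {C : ℝ} (hC : ∀ q, |u q| ≤ C) :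
    Integrable (fun q : V × V => f q.1 * g q.2 * u q) (volume.prod volume) :=
  (hf.mul_prod hg).mul_bdd hu.aestronglyMeasurable (ae_of_all _ hC)

theorem regKernel_sub_comm (v w : V) : regKernel p ε (v - w) = regKernel p ε (w - v) := by
  rw [regKernel, regKernel, norm_sub_rev]

theorem regKernelDeriv_sub_comm (v w : V) :
    regKernelDeriv p ε (v - w) = regKernelDeriv p ε (w - v) := by
  rw [regKernelDeriv, regKernelDeriv, norm_sub_rev]

theorem abs_regKernel_le (hp : p < 0) (hε : 0 < ε) (z : V) :
    |regKernel p ε z| ≤ ε ^ (p / 2) := by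
  rw [abs_of_nonneg (regKernel_nonneg hε z)]
  exact regKernel_le hp hε z

theorem abs_regSource_le (hp1 : -1 ≤ p) (hp : p < 0) (hε : 0 < ε) (z : V) :
    |regSource p ε z| ≤ 3 * ε ^ (p / 2 - 1) := by
  rw [abs_of_nonneg (regSource_nonneg hp1 hp hε z)]
  exact regSource_le_const hp1 hp hε z

/-- The bilinear density obtained by testing the regularized operator against `φ`. -/
noncomputable def weakDensity (p ε : ℝ) (φ : V → ℝ) (q : V × V) : ℝ :=
  regKernel p ε (q.1 - q.2) * Laplacian.laplacian φ q.1 +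
    4 * (regKernelDeriv p ε (q.1 - q.2) * fderiv ℝ φ q.1 (q.1 - q.2))

theorem continuous_weakDensity (hε : 0 < ε) {φ : V → ℝ} (hφ : ContDiff ℝ 2 φ) :
    Continuous (weakDensity p ε φ) := by
  have h1 : Continuous fun q : V × V => regKernel p ε (q.1 - q.2) :=
    (continuous_regKernel hε).comp (by fun_prop)
  have h2 : Continuous fun q : V × V => regKernelDeriv p ε (q.1 - q.2) :=
    (continuous_regKernelDeriv hε).comp (by fun_prop)
  have h3 : Continuous fun q : V × V => Laplacian.laplacian φ q.1 :=
    (continuous_laplacian hφ).comp (by fun_prop)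
  have h4 : Continuous fun q : V × V => fderiv ℝ φ q.1 (q.1 - q.2) :=
    ((hφ.continuous_fderiv (by norm_num)).comp continuous_fst).clm_apply (by fun_prop)
  exact (h1.mul h3).add (continuous_const.mul (h2.mul h4))

theorem exists_abs_weakDensity_le (hp1 : -1 ≤ p) (hp : p < 0) (hε : 0 < ε) {φ : V → ℝ}
    (hφ : ContDiff ℝ 2 φ) (hc : HasCompactSupport φ) :
    ∃ C, ∀ q, |weakDensity p ε φ q| ≤ C := by
  obtain ⟨C1, h1⟩ := (continuous_laplacian hφ).bounded_above_of_compact_support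
    (hasCompactSupport_laplacian hc)
  obtain ⟨C2, h2⟩ := (hφ.continuous_fderiv (by norm_num)).bounded_above_of_compact_support
    (hc.fderiv ℝ)
  refine ⟨ε ^ (p / 2) * C1 + 4 * ((ε ^ (p / 2 - 1) + ε ^ (p / 2)) * C2), fun q => ?_⟩
  have a1 := abs_regKernel_le hp hε (q.1 - q.2)
  have a2 := abs_regKernelDeriv_mul_le hp1 hp hε (q.1 - q.2)
  have a3 : |fderiv ℝ φ q.1 (q.1 - q.2)| ≤ C2 * ‖q.1 - q.2‖ :=
    ((fderiv ℝ φ q.1).le_opNorm _).trans (by gcongr; exact h2 _)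
  have hC2 : 0 ≤ C2 := (norm_nonneg _).trans (h2 0)
  refine (abs_add_le _ _).trans (add_le_add ?_ ?_)
  · rw [abs_mul]
    exact mul_le_mul a1 (h1 _) (abs_nonneg _) (by positivity)
  · rw [abs_mul, abs_mul, abs_of_pos (by norm_num : (0 : ℝ) < 4)]
    refine mul_le_mul_of_nonneg_left ?_ (by norm_num)
    calc |regKernelDeriv p ε (q.1 - q.2)| * |fderiv ℝ φ q.1 (q.1 - q.2)|
        ≤ |regKernelDeriv p ε (q.1 - q.2)| * (C2 * ‖q.1 - q.2‖) := by gcongr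
      _ = |regKernelDeriv p ε (q.1 - q.2)| * ‖q.1 - q.2‖ * C2 := by ring
      _ ≤ _ := by gcongr

/-- The kernel is even and its gradient odd, so adding the swapped density produces a difference of
gradients of φ, quadratically small when paired with v - w. The constant is 5 = 3 + 4 · 1/2: the
Laplacian contributes 3, the gradient term 4 times the 1/2 of `abs_regKernelDeriv_mul_sq_le`. -/
theorem weakDensity_add_swap_le (hp1 : -1 ≤ p) (hp : p < 0) (hε : 0 < ε) {φ L : V → ℝ}
    (hL : ∀ v, 0 ≤ L v) (hlap : ∀ v, Laplacian.laplacian φ v ≤ 3 * L v)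
    (hgrad : ∀ v w, |fderiv ℝ φ v (v - w) - fderiv ℝ φ w (v - w)| ≤ (L v + L w) * ‖v - w‖ ^ 2)
    (v w : V) :
    weakDensity p ε φ (v, w) + weakDensity p ε φ (w, v) ≤
      5 * (L v + L w) * regKernel p ε (v - w) := by
  have hK := regKernel_nonneg (p := p) hε (v - w)
  have h1 := abs_regKernelDeriv_mul_sq_le hp1 hp hε (v - w)
  have e : weakDensity p ε φ (v, w) + weakDensity p ε φ (w, v) =
      regKernel p ε (v - w) * (Laplacian.laplacian φ v + Laplacian.laplacian φ w) +
        4 * (regKernelDeriv p ε (v - w) *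
          (fderiv ℝ φ v (v - w) - fderiv ℝ φ w (v - w))) := by
    simp only [weakDensity]
    rw [regKernel_sub_comm w v, regKernelDeriv_sub_comm w v,
      show fderiv ℝ φ w (w - v) = -fderiv ℝ φ w (v - w) by rw [← map_neg, neg_sub]]
    ring
  have h2 : regKernelDeriv p ε (v - w) * (fderiv ℝ φ v (v - w) - fderiv ℝ φ w (v - w)) ≤
      (L v + L w) * (regKernel p ε (v - w) / 2) := by
    refine (le_abs_self _).trans ?_
    rw [abs_mul]
    have := add_nonneg (hL v) (hL w)
    calc _ ≤ |regKernelDeriv p ε (v - w)| * ((L v + L w) * ‖v - w‖ ^ 2) := by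
          gcongr
          exact hgrad v w
      _ = (L v + L w) * (|regKernelDeriv p ε (v - w)| * ‖v - w‖ ^ 2) := by ring
      _ ≤ _ := by gcongr
  have h3 : regKernel p ε (v - w) * (Laplacian.laplacian φ v + Laplacian.laplacian φ w) ≤
      regKernel p ε (v - w) * (3 * L v + 3 * L w) :=
    mul_le_mul_of_nonneg_left (add_le_add (hlap v) (hlap w)) hK
  rw [e]
  linarith

theorem integral_regularized_eq (hp1 : -1 ≤ p) (hp : p < 0) (hε : 0 < ε) {φ g : V → ℝ}
    (hφ : ContDiff ℝ 2 φ) (hc : HasCompactSupport φ) (hg : ContDiff ℝ 2 g)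
    (hgi : Integrable g) :
    ∫ v, (φ v * Laplacian.laplacian g v * (∫ w, g w * regKernel p ε (v - w)) +
        φ v * g v * ∫ w, g w * regSource p ε (v - w)) =
      ∫ q : V × V, g q.1 * g q.2 * weakDensity p ε φ q ∂(volume.prod volume) := by
  have cK : Continuous fun q : V × V => regKernel p ε (q.1 - q.2) :=
    (continuous_regKernel hε).comp (by fun_prop)
  have cS : Continuous fun q : V × V => regSource p ε (q.1 - q.2) :=
    (continuous_regSource hε).comp (by fun_prop)
  have i1 : Integrable fun v => φ v * Laplacian.laplacian g v :=
    (hφ.continuous.mul (continuous_laplacian hg)).integrable_of_hasCompactSupport hc.mul_right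
  have i2 : Integrable fun v => φ v * g v :=
    (hφ.continuous.mul hg.continuous).integrable_of_hasCompactSupport hc.mul_right
  have I1 := integrable_prod_mul_bdd i1 hgi cK (fun q => abs_regKernel_le hp hε (q.1 - q.2))
  have I2 := integrable_prod_mul_bdd i2 hgi cS (fun q => abs_regSource_le hp1 hp hε (q.1 - q.2))
  obtain ⟨C, hC⟩ := exists_abs_weakDensity_le hp1 hp hε hφ hc
  have I3 := integrable_prod_mul_bdd hgi hgi (continuous_weakDensity (p := p) hε hφ) hC
  have sK : ∀ v, Integrable fun w => g w * regKernel p ε (v - w) := fun v =>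
    hgi.mul_bdd ((continuous_regKernel hε).comp
      (continuous_const.sub continuous_id)).aestronglyMeasurable
      (ae_of_all _ fun w => abs_regKernel_le hp hε (v - w))
  have sS : ∀ v, Integrable fun w => g w * regSource p ε (v - w) := fun v =>
    hgi.mul_bdd ((continuous_regSource hε).comp
      (continuous_const.sub continuous_id)).aestronglyMeasurable
      (ae_of_all _ fun w => abs_regSource_le hp1 hp hε (v - w))
  calc ∫ v, (φ v * Laplacian.laplacian g v * (∫ w, g w * regKernel p ε (v - w)) +
        φ v * g v * ∫ w, g w * regSource p ε (v - w))
      = ∫ v, ∫ w, (φ v * Laplacian.laplacian g v * g w * regKernel p ε (v - w) +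
          φ v * g v * g w * regSource p ε (v - w)) := by
        refine integral_congr_ae (ae_of_all _ fun v => ?_)
        simp only []
        rw [← integral_const_mul, ← integral_const_mul,
          ← integral_add ((sK v).const_mul _) ((sS v).const_mul _)]
        exact integral_congr_ae (ae_of_all _ fun w => by ring)
    _ = ∫ w, ∫ v, (φ v * Laplacian.laplacian g v * g w * regKernel p ε (v - w) +
          φ v * g v * g w * regSource p ε (v - w)) := integral_integral_swap (I1.add I2)
    _ = ∫ w, ∫ v, g v * g w * weakDensity p ε φ (v, w) := by
        refine integral_congr_ae (ae_of_all _ fun w => ?_)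
        simp only []
        have := congrArg (fun x => g w * x) (integral_regKernel_green (p := p) hε hφ hc hg w)
        simp only [← integral_const_mul] at this
        calc _ = _ := integral_congr_ae (ae_of_all _ fun v => by ring)
          _ = _ := this
          _ = _ := integral_congr_ae (ae_of_all _ fun v => by simp only [weakDensity]; ring)
    _ = ∫ v, ∫ w, g v * g w * weakDensity p ε φ (v, w) := (integral_integral_swap I3).symm
    _ = _ := (integral_prod _ I3).symm

/-- Both sides of the pointwise bound are integrated together with their swaps, which doubles each
side; the factor 2 drops out. The bound depends on ε only through `A`, hence survives the limit. -/
theorem integral_weakDensity_le (hp1 : -1 ≤ p) (hp : p < 0) (hε : 0 < ε) {φ g L : V → ℝ}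
    (hφ : ContDiff ℝ 2 φ) (hc : HasCompactSupport φ) (hg0 : ∀ v, 0 ≤ g v)
    (hgi : Integrable g) (hL : ∀ v, 0 ≤ L v)
    (hlap : ∀ v, Laplacian.laplacian φ v ≤ 3 * L v)
    (hgrad : ∀ v w, |fderiv ℝ φ v (v - w) - fderiv ℝ φ w (v - w)| ≤ (L v + L w) * ‖v - w‖ ^ 2)
    (hgL : Integrable fun v => g v * L v) {A : ℝ}
    (hA : ∀ v, ∫ w, g w * regKernel p ε (v - w) ≤ A) :
    ∫ q : V × V, g q.1 * g q.2 * weakDensity p ε φ q ∂(volume.prod volume) ≤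
      5 * (A * ∫ v, g v * L v) := by
  have cK : Continuous fun q : V × V => regKernel p ε (q.1 - q.2) :=
    (continuous_regKernel hε).comp (by fun_prop)
  have I1 := integrable_prod_mul_bdd hgL hgi cK (fun q => abs_regKernel_le hp hε (q.1 - q.2))
  obtain ⟨C, hC⟩ := exists_abs_weakDensity_le hp1 hp hε hφ hc
  have I3 := integrable_prod_mul_bdd hgi hgi (continuous_weakDensity (p := p) hε hφ) hC
  have e1 := integral_prod_swap (μ := (volume : Measure V)) (ν := (volume : Measure V))
    (fun q : V × V => g q.1 * g q.2 * weakDensity p ε φ q)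
  have e2 := integral_prod_swap (μ := (volume : Measure V)) (ν := (volume : Measure V))
    (fun q : V × V => g q.1 * L q.1 * g q.2 * regKernel p ε (q.1 - q.2))
  have key : ∫ q : V × V, (g q.1 * g q.2 * weakDensity p ε φ q +
        g q.swap.1 * g q.swap.2 * weakDensity p ε φ q.swap) ∂(volume.prod volume) ≤
      ∫ q : V × V, 5 * (g q.1 * L q.1 * g q.2 * regKernel p ε (q.1 - q.2) +
        g q.swap.1 * L q.swap.1 * g q.swap.2 * regKernel p ε (q.swap.1 - q.swap.2))
          ∂(volume.prod volume) := by
    refine integral_mono (I3.add I3.swap) ((I1.add I1.swap).const_mul 5) fun q => ?_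
    have h := weakDensity_add_swap_le hp1 hp hε hL hlap hgrad q.1 q.2
    have hgg := mul_nonneg (hg0 q.1) (hg0 q.2)
    have := mul_le_mul_of_nonneg_left h hgg
    have e := regKernel_sub_comm (p := p) (ε := ε) q.2 q.1
    simp only [Prod.fst_swap, Prod.snd_swap, e]
    simp only [Prod.swap]
    linarith
  have I3' : Integrable (fun q : V × V =>
      g q.swap.1 * g q.swap.2 * weakDensity p ε φ q.swap) (volume.prod volume) := I3.swap
  have I1' : Integrable (fun q : V × V => g q.swap.1 * L q.swap.1 * g q.swap.2 *
      regKernel p ε (q.swap.1 - q.swap.2)) (volume.prod volume) := I1.swap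
  rw [integral_add I3 I3', integral_const_mul, integral_add I1 I1', e1, e2] at key
  have h1 : ∫ q : V × V, g q.1 * L q.1 * g q.2 * regKernel p ε (q.1 - q.2)
      ∂(volume.prod volume) ≤ A * ∫ v, g v * L v := by
    rw [integral_prod _ I1, ← integral_const_mul]
    refine integral_mono I1.integral_prod_left (hgL.const_mul A) fun v => ?_
    simp only []
    have h := mul_le_mul_of_nonneg_left (hA v) (mul_nonneg (hg0 v) (hL v))
    rw [← integral_const_mul] at h
    calc _ = _ := integral_congr_ae (ae_of_all _ fun w => by ring)
      _ ≤ _ := h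
      _ = _ := by ring
  linarith

end Regularized

/-! ### Bounds on the potentials and the Coulomb source -/

section Potential

theorem integrable_indicator_ball_rpow {q : ℝ} (hq : -3 < q) :
    Integrable ((Metric.ball (0 : V) 1).indicator fun z => ‖z‖ ^ q) := by
  rw [integrable_indicator_iff measurableSet_ball]
  refine (integrableOn_fun_norm_addHaar (μ := (volume : Measure V)) (f := fun y => y ^ q)).2 ?_
  have h : IntegrableOn (fun y : ℝ => y ^ (q + 2)) (Ioo 0 1) :=
    (intervalIntegral.integrableOn_Ioo_rpow_iff one_pos).2 (by linarith)
  refine h.congr_fun (fun y hy => ?_) measurableSet_Ioo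
  simp only [finrank_euclideanSpace, Fintype.card_fin, smul_eq_mul]
  rw [Real.rpow_add hy.1, mul_comm]
  norm_num

theorem measurable_norm_sub_rpow (q : ℝ) (v : V) : Measurable fun w : V => ‖v - w‖ ^ q := by
  fun_prop

/-- Within distance 1 of v, g is bounded locally and the singularity is kept; farther away the power
is at most 1. The majorant depends on v only by translation, which gives bounds uniform on balls. -/
theorem mul_rpow_le_indicator {q : ℝ} (hq : q ≤ 0) {g : V → ℝ} (hg0 : ∀ v, 0 ≤ g v) {R S : ℝ}
    (hS : ∀ w ∈ Metric.closedBall (0 : V) (R + 1), g w ≤ S) {v : V}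
    (hv : v ∈ Metric.closedBall (0 : V) R) (w : V) :
    g w * ‖v - w‖ ^ q ≤ S * (Metric.ball (0 : V) 1).indicator (fun z => ‖z‖ ^ q) (v - w) + g w := by
  have h := hg0 w
  by_cases hw : v - w ∈ Metric.ball (0 : V) 1
  · rw [indicator_of_mem hw]
    have : g w ≤ S := by
      apply hS
      rw [mem_closedBall_zero_iff] at hv ⊢
      rw [mem_ball_zero_iff] at hw
      calc ‖w‖ = ‖v - (v - w)‖ := by simp
        _ ≤ ‖v‖ + ‖v - w‖ := norm_sub_le _ _
        _ ≤ R + 1 := by linarith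
    have h2 : 0 ≤ ‖v - w‖ ^ q := by positivity
    nlinarith
  · rw [indicator_of_notMem hw, mul_zero, zero_add]
    rw [mem_ball_zero_iff, not_lt] at hw
    exact mul_le_of_le_one_right h (Real.rpow_le_one_of_one_le_of_nonpos hw hq)

theorem exists_bound_closedBall {g : V → ℝ} (hg : Continuous g) (R : ℝ) :
    ∃ S, 0 ≤ S ∧ ∀ w ∈ Metric.closedBall (0 : V) R, g w ≤ S := by
  obtain ⟨S, hS⟩ := (isCompact_closedBall (0 : V) R).bddAbove_image hg.continuousOn
  exact ⟨max S 0, le_max_right _ _, fun w hw => (hS (mem_image_of_mem g hw)).trans (le_max_left _ _)⟩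

theorem integrable_mul_rpow {q : ℝ} (hq : -3 < q) (hq0 : q ≤ 0) {g : V → ℝ} (hg : Continuous g)
    (hg0 : ∀ v, 0 ≤ g v) (hgi : Integrable g) (v : V) :
    Integrable fun w => g w * ‖v - w‖ ^ q := by
  obtain ⟨S, hS0, hS⟩ := exists_bound_closedBall hg (‖v‖ + 1)
  refine Integrable.mono' ((((integrable_indicator_ball_rpow hq).comp_sub_left v).const_mul S).add
    hgi) (hg.measurable.mul (measurable_norm_sub_rpow q v)).aestronglyMeasurable
    (ae_of_all _ fun w => ?_)
  rw [Real.norm_of_nonneg (mul_nonneg (hg0 w) (by positivity))]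
  exact mul_rpow_le_indicator hq0 hg0 hS (by simp) w

/-- Young's inequality with exponents 3 and 3/2, applied to a and |z|^(-1), which dominates |z|^p in
the unit ball. The power |z|^(-3/2) is locally integrable on ℝ³ and serves all p ≥ -1 at once. -/
theorem mul_rpow_le_add_cube {p : ℝ} (hp1 : -1 ≤ p) (hp : p < 0) {a : ℝ} (ha : 0 ≤ a) (z : V) :
    a * ‖z‖ ^ p ≤ a + a ^ 3 + (Metric.ball (0 : V) 1).indicator (fun z => ‖z‖ ^ (-(3 / 2) : ℝ)) z := by
  have h3 : 0 ≤ a ^ 3 := by positivity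
  have hi : 0 ≤ (Metric.ball (0 : V) 1).indicator (fun z => ‖z‖ ^ (-(3 / 2) : ℝ)) z :=
    indicator_nonneg (fun z _ => by positivity) z
  by_cases hz : ‖z‖ < 1
  · rcases (norm_nonneg z).eq_or_lt with h0 | h0
    -- At z = 0 the real power takes the default value 0 and the bound is trivial.
    · rw [← h0, Real.zero_rpow hp.ne]
      linarith
    rw [indicator_of_mem (by simpa using hz)]
    set r := ‖z‖
    have e1 : r ^ p ≤ r ^ (-1 : ℝ) := Real.rpow_le_rpow_of_exponent_ge h0 hz.le hp1
    set u := r ^ (-(1 / 2) : ℝ) with hu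
    have hu0 : 0 < u := Real.rpow_pos_of_pos h0 _
    have e2 : r ^ (-1 : ℝ) = u ^ 2 := by
      rw [hu, ← Real.rpow_natCast, ← Real.rpow_mul h0.le]; norm_num
    have e3 : r ^ (-(3 / 2) : ℝ) = u ^ 3 := by
      rw [hu, ← Real.rpow_natCast, ← Real.rpow_mul h0.le]; norm_num
    rw [e3]
    rw [e2] at e1
    have : a * u ^ 2 ≤ a ^ 3 + u ^ 3 := by
      rcases le_total a u with h | h
      · nlinarith [mul_le_mul_of_nonneg_right h (sq_nonneg u)]
      · have : u ^ 2 ≤ a ^ 2 := by gcongr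
        nlinarith [mul_le_mul_of_nonneg_left this ha, pow_pos hu0 3]
    nlinarith [mul_le_mul_of_nonneg_left e1 ha]
  · have : a * ‖z‖ ^ p ≤ a :=
      mul_le_of_le_one_right ha (Real.rpow_le_one_of_one_le_of_nonpos (not_lt.1 hz) hp.le)
    linarith

/-- The integral of `|z|^(-3/2)` over the unit ball. -/
noncomputable def ballConst : ℝ :=
  ∫ z : V, (Metric.ball (0 : V) 1).indicator (fun z => ‖z‖ ^ (-(3 / 2) : ℝ)) z

theorem ballConst_nonneg : 0 ≤ ballConst :=
  integral_nonneg fun z => indicator_nonneg (fun z _ => by positivity) z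

theorem diffusion_le {p : ℝ} (hp1 : -1 ≤ p) (hp : p < 0) {g : V → ℝ} (hg : Continuous g)
    (hg0 : ∀ v, 0 ≤ g v) (hgi : Integrable g) (hg3 : Integrable fun v => g v ^ 3) (v : V) :
    ∫ w, g w * ‖v - w‖ ^ p ≤ (∫ w, g w) + (∫ w, g w ^ 3) + ballConst := by
  have hb := (integrable_indicator_ball_rpow (q := -(3 / 2)) (by norm_num)).comp_sub_left v
  have e : ballConst = ∫ w, (Metric.ball (0 : V) 1).indicator
      (fun z => ‖z‖ ^ (-(3 / 2) : ℝ)) (v - w) :=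
    (integral_sub_left_eq_self _ volume v).symm
  have h2 : Integrable fun w => g w + g w ^ 3 := hgi.add hg3
  rw [e, ← integral_add hgi hg3, ← integral_add h2 hb]
  exact integral_mono (integrable_mul_rpow (by linarith) hp.le hg hg0 hgi v) (h2.add hb)
    fun w => mul_rpow_le_add_cube hp1 hp (hg0 w) (v - w)

theorem integral_mul_regKernel_le {p ε : ℝ} (hp1 : -1 ≤ p) (hp : p < 0) (hε : 0 < ε) {g : V → ℝ}
    (hg : Continuous g) (hg0 : ∀ v, 0 ≤ g v) (hgi : Integrable g) (v : V) :
    ∫ w, g w * regKernel p ε (v - w) ≤ ∫ w, g w * ‖v - w‖ ^ p := by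
  refine integral_mono_ae (hgi.mul_bdd ((continuous_regKernel hε).comp
    (continuous_const.sub continuous_id)).aestronglyMeasurable
      (ae_of_all _ fun w => abs_regKernel_le hp hε (v - w)))
    (integrable_mul_rpow (by linarith) hp.le hg hg0 hgi v) ?_
  -- The point w = v must be excluded: there |v - w|^p is 0 by convention, while the regularized
  -- kernel is positive.
  filter_upwards [Measure.ae_ne volume v] with w hw
  exact mul_le_mul_of_nonneg_left (regKernel_le_rpow hp hε (sub_ne_zero.2 hw.symm)) (hg0 w)

/-- In polar coordinates the integrand is 3y²(y²+1)^(-5/2), whose primitive y³(y²+1)^(-3/2) runs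
from 0 to 1. -/
theorem integral_regSource_coulomb : ∫ z : V, regSource (-1) 1 z = 4 * Real.pi := by
  have hb : (volume : Measure V).real (Metric.ball 0 1) = 4 * Real.pi / 3 := by
    rw [Measure.real, InnerProductSpace.volume_ball_of_dim_odd (k := 1) (by simp)]
    simp
    rw [ENNReal.toReal_ofReal (by positivity)]
    norm_num
    ring
  have e := integral_fun_norm_addHaar (volume : Measure V)
    (fun y : ℝ => 3 * (y ^ 2 + 1) ^ (-(5 / 2) : ℝ))
  have e0 : ∀ z : V, regSource (-1) 1 z = 3 * (‖z‖ ^ 2 + 1) ^ (-(5 / 2) : ℝ) := by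
    intro z
    rw [regSource]
    norm_num
    ring
  simp_rw [e0]
  rw [e, hb]
  have e1 : ∫ y in Ioi (0 : ℝ), y ^ (Module.finrank ℝ V - 1) • (3 * (y ^ 2 + 1) ^ (-(5 / 2) : ℝ))
      = 1 - 0 := by
    have h0 : (0 : ℝ) = (fun y : ℝ => y ^ 3 * (y ^ 2 + 1) ^ (-(3 / 2) : ℝ)) 0 := by simp
    conv_rhs => rw [h0]
    refine integral_Ioi_of_hasDerivAt_of_nonneg'
      (g := fun y : ℝ => y ^ 3 * (y ^ 2 + 1) ^ (-(3 / 2) : ℝ)) (a := 0) (l := 1)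
      (g' := fun y : ℝ => y ^ (Module.finrank ℝ V - 1) • (3 * (y ^ 2 + 1) ^ (-(5 / 2) : ℝ)))
      (fun y hy => ?_) (fun y hy => ?_) ?_
    · have hp : 0 < y ^ 2 + 1 := by positivity
      have h1 := (hasDerivAt_pow 3 y).fun_mul
        ((((hasDerivAt_pow 2 y).add_const 1)).rpow_const (p := (-(3 / 2) : ℝ)) (Or.inl hp.ne'))
      refine h1.congr_deriv ?_
      have e2 : (y ^ 2 + 1) ^ (-(3 / 2) : ℝ) = (y ^ 2 + 1) ^ (-(5 / 2) : ℝ) * (y ^ 2 + 1) := by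
        rw [← Real.rpow_add_one hp.ne']
        norm_num
      have e3 : (-(3 / 2) : ℝ) - 1 = -(5 / 2) := by norm_num
      rw [finrank_euclideanSpace, Fintype.card_fin, smul_eq_mul]
      rw [e3, e2]
      push_cast
      ring
    · have := mem_Ioi.1 hy
      simp only [smul_eq_mul]
      positivity
    -- For y > 0 the primitive equals (1 + y⁻²)^(-3/2).
    · have h1 : Tendsto (fun y : ℝ => (1 + (y ^ 2)⁻¹) ^ (-(3 / 2) : ℝ)) atTop (𝓝 1) := by
        have : Tendsto (fun y : ℝ => 1 + (y ^ 2)⁻¹) atTop (𝓝 (1 + 0)) :=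
          tendsto_const_nhds.add (tendsto_inv_atTop_zero.comp (tendsto_pow_atTop (by norm_num)))
        have h := this.rpow_const (p := (-(3 / 2) : ℝ)) (Or.inl (by norm_num))
        simpa using h
      refine h1.congr' ?_
      filter_upwards [eventually_gt_atTop 0] with y hy
      have e4 : 1 + (y ^ 2)⁻¹ = (y ^ 2 + 1) * (y ^ 2)⁻¹ := by field_simp
      rw [e4, Real.mul_rpow (by positivity) (by positivity), mul_comm]
      congr 1
      rw [Real.inv_rpow (by positivity), ← Real.rpow_neg (by positivity), ← Real.rpow_natCast,
        ← Real.rpow_mul hy.le, ← Real.rpow_natCast]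
      norm_num
  rw [e1]
  simp
  ring

/-- With ε = c⁻² the Coulomb sources are the dilates of one profile that preserve its integral: an
approximate identity of mass 4π. This dictates the choice of `regScale`. -/
theorem regSource_coulomb_scale {c : ℝ} (hc : 0 < c) (z : V) :
    regSource (-1) ((c ^ 2)⁻¹) z = c ^ 3 * regSource (-1) 1 (c • z) := by
  have e : ‖z‖ ^ 2 + (c ^ 2)⁻¹ = (‖c • z‖ ^ 2 + 1) * (c ^ 2)⁻¹ := by
    rw [norm_smul, Real.norm_of_nonneg hc.le]
    field_simp
  have e2 : ((c ^ 2)⁻¹ : ℝ) ^ (-1 / 2 - 2 : ℝ) = c ^ 5 := by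
    rw [Real.inv_rpow (by positivity), ← Real.rpow_neg (by positivity), ← Real.rpow_natCast,
        ← Real.rpow_mul hc.le, ← Real.rpow_natCast]
    norm_num
  rw [regSource, regSource, e, Real.mul_rpow (by positivity) (by positivity), e2]
  field_simp
  ring

theorem integral_regSource_coulomb_scale {c : ℝ} (hc : 0 < c) :
    ∫ z : V, regSource (-1) ((c ^ 2)⁻¹) z = 4 * Real.pi := by
  simp_rw [regSource_coulomb_scale hc]
  rw [integral_const_mul, Measure.integral_comp_smul_of_nonneg _ _ _ (hR := hc.le),
    integral_regSource_coulomb]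
  simp only [finrank_euclideanSpace, Fintype.card_fin, smul_eq_mul]
  field_simp

end Potential

/-! ### Removal of the regularization -/

section Limit

theorem tendsto_nhds_of_eq {u : ℕ → ℝ} {a b : ℝ} (h : Tendsto u atTop (𝓝 a)) (e : a = b) :
    Tendsto u atTop (𝓝 b) := e ▸ h

/-- A sequence of regularization parameters tending to zero. -/
noncomputable def regScale (n : ℕ) : ℝ := (((n : ℝ) + 1) ^ 2)⁻¹

theorem regScale_pos (n : ℕ) : 0 < regScale n := by
  rw [regScale]
  positivity

theorem tendsto_regScale : Tendsto regScale atTop (𝓝 0) :=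
  tendsto_inv_atTop_zero.comp ((tendsto_pow_atTop (by norm_num)).comp
    (tendsto_atTop_add_const_right _ _ tendsto_natCast_atTop_atTop))

theorem rpow_norm_sq {z : V} (q : ℝ) : (‖z‖ ^ 2) ^ (q / 2) = ‖z‖ ^ q := by
  rw [← Real.rpow_natCast, ← Real.rpow_mul (norm_nonneg z)]
  congr 1
  push_cast
  ring

theorem tendsto_norm_sq_add_rpow {z : V} (hz : z ≠ 0) (q : ℝ) :
    Tendsto (fun n => (‖z‖ ^ 2 + regScale n) ^ (q / 2)) atTop (𝓝 (‖z‖ ^ q)) := by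
  have h : Tendsto (fun n => ‖z‖ ^ 2 + regScale n) atTop (𝓝 (‖z‖ ^ 2 + 0)) :=
    tendsto_const_nhds.add tendsto_regScale
  have hz' : 0 < ‖z‖ := norm_pos_iff.2 hz
  have := h.rpow_const (p := q / 2) (Or.inl (by positivity))
  rwa [add_zero, rpow_norm_sq] at this

theorem tendsto_regSource {p : ℝ} {z : V} (hz : z ≠ 0) :
    Tendsto (fun n => regSource p (regScale n) z) atTop (𝓝 (-(p * (1 + p)) * ‖z‖ ^ (p - 2))) := by
  have h1 := tendsto_norm_sq_add_rpow hz (p - 4)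
  have h2 : Tendsto (fun n => (1 + p) * ‖z‖ ^ 2 + 3 * regScale n) atTop
      (𝓝 ((1 + p) * ‖z‖ ^ 2 + 3 * 0)) :=
    tendsto_const_nhds.add (tendsto_regScale.const_mul 3)
  have h3 := (h1.const_mul (-p)).mul h2
  have hz' : 0 < ‖z‖ := norm_pos_iff.2 hz
  have e : ‖z‖ ^ (p - 2) = ‖z‖ ^ (p - 4) * ‖z‖ ^ 2 := by
    rw [← Real.rpow_natCast, ← Real.rpow_add hz']
    norm_num
    ring_nf
  have e2 : (p - 4) / 2 = p / 2 - 2 := by ring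
  rw [e2] at h3
  rw [e]
  refine tendsto_nhds_of_eq h3 ?_
  ring

theorem regSource_le_rpow {p ε : ℝ} (hp1 : -1 ≤ p) (hp : p < 0) (hε : 0 < ε) {z : V}
    (hz : z ≠ 0) : regSource p ε z ≤ 3 * ‖z‖ ^ (p - 2) := by
  have hz' : 0 < ‖z‖ := norm_pos_iff.2 hz
  refine (regSource_le hp1 hp hε z).trans (mul_le_mul_of_nonneg_left ?_ (by norm_num))
  rw [← rpow_norm_sq]
  have e : p / 2 - 1 = (p - 2) / 2 := by ring
  rw [e]
  exact Real.rpow_le_rpow_of_nonpos (by positivity) (by linarith) (by linarith)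

variable {p : ℝ} {g : V → ℝ}

theorem integrable_mul_regSource {ε : ℝ} (hp1 : -1 ≤ p) (hp : p < 0) (hε : 0 < ε)
    (hgi : Integrable g) (v : V) : Integrable fun w => g w * regSource p ε (v - w) :=
  hgi.mul_bdd ((continuous_regSource hε).comp
    (continuous_const.sub continuous_id)).aestronglyMeasurable
    (ae_of_all _ fun w => abs_regSource_le hp1 hp hε (v - w))

theorem integrable_mul_regKernel {ε : ℝ} (hp : p < 0) (hε : 0 < ε)
    (hgi : Integrable g) (v : V) : Integrable fun w => g w * regKernel p ε (v - w) :=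
  hgi.mul_bdd ((continuous_regKernel hε).comp
    (continuous_const.sub continuous_id)).aestronglyMeasurable
    (ae_of_all _ fun w => abs_regKernel_le hp hε (v - w))

theorem tendsto_integral_mul_regKernel (hp1 : -1 ≤ p) (hp : p < 0) (hg : Continuous g)
    (hg0 : ∀ v, 0 ≤ g v) (hgi : Integrable g) (v : V) :
    Tendsto (fun n => ∫ w, g w * regKernel p (regScale n) (v - w)) atTop
      (𝓝 (∫ w, g w * ‖v - w‖ ^ p)) := by
  refine tendsto_integral_of_dominated_convergence (fun w => g w * ‖v - w‖ ^ p)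
    (fun n => (integrable_mul_regKernel hp (regScale_pos n) hgi v).aestronglyMeasurable)
    (integrable_mul_rpow (by linarith) hp.le hg hg0 hgi v) (fun n => ?_) ?_
  · filter_upwards [Measure.ae_ne volume v] with w hw
    rw [Real.norm_of_nonneg (mul_nonneg (hg0 w) (regKernel_nonneg (regScale_pos n) _))]
    exact mul_le_mul_of_nonneg_left
      (regKernel_le_rpow hp (regScale_pos n) (sub_ne_zero.2 hw.symm)) (hg0 w)
  · filter_upwards [Measure.ae_ne volume v] with w hw
    exact (tendsto_norm_sq_add_rpow (sub_ne_zero.2 hw.symm) p).const_mul _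

/-- For p > -1 the dominating power |z|^(p-2) is still locally integrable. At p = -1 it becomes
|z|^(-3), and the Coulomb case needs a different argument. -/
theorem tendsto_integral_mul_regSource (hp1 : -1 < p) (hp : p < 0) (hg : Continuous g)
    (hg0 : ∀ v, 0 ≤ g v) (hgi : Integrable g) (v : V) :
    Tendsto (fun n => ∫ w, g w * regSource p (regScale n) (v - w)) atTop
      (𝓝 (-(p * (1 + p)) * ∫ w, g w * ‖v - w‖ ^ (p - 2))) := by
  have hI := integrable_mul_rpow (q := p - 2) (by linarith) (by linarith) hg hg0 hgi v
  rw [← integral_const_mul]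
  refine tendsto_integral_of_dominated_convergence (fun w => 3 * (g w * ‖v - w‖ ^ (p - 2)))
    (fun n => (integrable_mul_regSource hp1.le hp (regScale_pos n) hgi v).aestronglyMeasurable)
    (hI.const_mul 3) (fun n => ?_) ?_
  · filter_upwards [Measure.ae_ne volume v] with w hw
    rw [Real.norm_of_nonneg (mul_nonneg (hg0 w) (regSource_nonneg hp1.le hp (regScale_pos n) _))]
    have := mul_le_mul_of_nonneg_left
      (regSource_le_rpow hp1.le hp (regScale_pos n) (sub_ne_zero.2 hw.symm)) (hg0 w)
    linarith
  · filter_upwards [Measure.ae_ne volume v] with w hw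
    have := (tendsto_regSource (p := p) (sub_ne_zero.2 hw.symm)).const_mul (g w)
    refine tendsto_nhds_of_eq this ?_
    ring

/-- Uniformity in n and in v on balls provides the majorant when the limit is taken under the
integral against φ. -/
theorem exists_integral_mul_regSource_le (hp1 : -1 < p) (hp : p < 0) (hg : Continuous g)
    (hg0 : ∀ v, 0 ≤ g v) (hgi : Integrable g) (R : ℝ) :
    ∃ C, ∀ n, ∀ v ∈ Metric.closedBall (0 : V) R,
      ∫ w, g w * regSource p (regScale n) (v - w) ≤ C := by
  obtain ⟨S, hS0, hS⟩ := exists_bound_closedBall hg (R + 1)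
  have hb := integrable_indicator_ball_rpow (q := p - 2) (by linarith)
  refine ⟨3 * (S * (∫ z : V, (Metric.ball (0 : V) 1).indicator (fun z => ‖z‖ ^ (p - 2)) z) +
    ∫ w, g w), fun n v hv => ?_⟩
  have hb' := (hb.comp_sub_left v).const_mul S
  rw [← integral_sub_left_eq_self ((Metric.ball (0 : V) 1).indicator _) volume v, ← integral_const_mul,
    ← integral_add hb' hgi, ← integral_const_mul]
  refine integral_mono_ae (integrable_mul_regSource hp1.le hp (regScale_pos n) hgi v)
    ((hb'.add hgi).const_mul 3) ?_
  filter_upwards [Measure.ae_ne volume v] with w hw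
  have := mul_le_mul_of_nonneg_left
    (regSource_le_rpow hp1.le hp (regScale_pos n) (sub_ne_zero.2 hw.symm)) (hg0 w)
  have h2 := mul_rpow_le_indicator (q := p - 2) (by linarith) hg0 hS hv w
  linarith

/-- The rescaled source tends to 4πδ. Since `g` is only integrable and continuous, the
approximate-identity theorem asks for |z|³S(z) → 0 at infinity, where S is the unscaled profile;
here S = O(|z|⁻⁵). -/
theorem tendsto_integral_mul_regSource_coulomb (hg : Continuous g) (hgi : Integrable g) (v : V) :
    Tendsto (fun n => ∫ w, g w * regSource (-1) (regScale n) (v - w)) atTop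
      (𝓝 (4 * Real.pi * g v)) := by
  have hpi := Real.pi_pos
  have key := tendsto_integral_comp_smul_smul_of_integrable' (μ := (volume : Measure V))
    (φ := fun z => (4 * Real.pi)⁻¹ * regSource (-1) 1 z)
    (fun z => mul_nonneg (by positivity) (regSource_nonneg le_rfl (by norm_num) one_pos z))
    (by rw [integral_const_mul, integral_regSource_coulomb]; field_simp)
    ?_ hgi (hg.continuousAt (x := v))
  · have h2 := (key.comp (tendsto_atTop_add_const_right _ (1 : ℝ)
      tendsto_natCast_atTop_atTop)).const_mul (4 * Real.pi)
    refine h2.congr fun n => ?_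
    simp only [Function.comp_apply]
    rw [← integral_const_mul]
    refine integral_congr_ae (ae_of_all _ fun w => ?_)
    simp only [regScale]
    rw [regSource_coulomb_scale (by positivity : (0 : ℝ) < n + 1)]
    simp only [finrank_euclideanSpace, Fintype.card_fin, smul_eq_mul]
    field_simp
  · have h1 : Tendsto (fun z : V => (4 * Real.pi)⁻¹ * (3 * ‖z‖⁻¹ ^ 2))
        (Bornology.cobounded V) (𝓝 0) := by
      have := ((((tendsto_inv_atTop_zero (𝕜 := ℝ)).comp
        (tendsto_norm_cobounded_atTop (E := V))).pow 2).const_mul 3).const_mul (4 * Real.pi)⁻¹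
      simpa using this
    refine squeeze_zero' (Eventually.of_forall fun z => mul_nonneg (by positivity)
      (mul_nonneg (by positivity) (regSource_nonneg le_rfl (by norm_num) one_pos z))) ?_ h1
    have hne : ∀ᶠ z : V in Bornology.cobounded V, 0 < ‖z‖ :=
      tendsto_norm_cobounded_atTop.eventually (eventually_gt_atTop 0)
    filter_upwards [hne] with z hz
    have e : regSource (-1) 1 z ≤ 3 * ‖z‖⁻¹ ^ 5 := by
      have : regSource (-1) 1 z = 3 * (‖z‖ ^ 2 + 1) ^ ((-5 : ℝ) / 2) := by
        rw [regSource]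
        norm_num
        ring
      rw [this]
      refine mul_le_mul_of_nonneg_left ?_ (by norm_num)
      calc (‖z‖ ^ 2 + 1) ^ ((-5 : ℝ) / 2) ≤ (‖z‖ ^ 2) ^ ((-5 : ℝ) / 2) :=
            Real.rpow_le_rpow_of_nonpos (by positivity) (by linarith) (by norm_num)
        _ = ‖z‖⁻¹ ^ 5 := by
            rw [rpow_norm_sq, Real.rpow_neg hz.le, inv_pow]
            norm_cast
    simp only [finrank_euclideanSpace, Fintype.card_fin]
    calc ‖z‖ ^ 3 * ((4 * Real.pi)⁻¹ * regSource (-1) 1 z)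
        ≤ ‖z‖ ^ 3 * ((4 * Real.pi)⁻¹ * (3 * ‖z‖⁻¹ ^ 5)) := by gcongr
      _ = _ := by field_simp

theorem exists_integral_mul_regSource_coulomb_le (hg : Continuous g)
    (hg0 : ∀ v, 0 ≤ g v) (hgi : Integrable g) (R : ℝ) :
    ∃ C, ∀ n, ∀ v ∈ Metric.closedBall (0 : V) R,
      ∫ w, g w * regSource (-1) (regScale n) (v - w) ≤ C := by
  obtain ⟨S, hS0, hS⟩ := exists_bound_closedBall hg (R + 1)
  refine ⟨S * (4 * Real.pi) + 3 * ∫ w, g w, fun n v hv => ?_⟩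
  have hI : ∫ z : V, regSource (-1) (regScale n) z = 4 * Real.pi :=
    integral_regSource_coulomb_scale (by positivity)
  -- A non-integrable function would have Bochner integral 0, so the nonzero value 4π already proves
  -- integrability.
  have hb : Integrable (regSource (-1) (regScale n)) :=
    Integrable.of_integral_ne_zero (by rw [hI]; positivity)
  have hb' := (hb.comp_sub_left v).const_mul S
  have hε := regScale_pos n
  rw [← hI, ← integral_sub_left_eq_self (regSource (-1) (regScale n)) volume v,
    ← integral_const_mul, ← integral_const_mul, ← integral_add hb' (hgi.const_mul 3)]
  refine integral_mono (integrable_mul_regSource le_rfl (by norm_num) hε hgi v)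
    (hb'.add (hgi.const_mul 3)) fun w => ?_
  have h0 := regSource_nonneg le_rfl (by norm_num) hε (v - w)
  have hgw := hg0 w
  beta_reduce
  rw [mem_closedBall_zero_iff] at hv
  by_cases hw : ‖v - w‖ < 1
  · have : g w ≤ S := by
      apply hS
      rw [mem_closedBall_zero_iff]
      calc ‖w‖ = ‖v - (v - w)‖ := by simp
        _ ≤ ‖v‖ + ‖v - w‖ := norm_sub_le _ _
        _ ≤ R + 1 := by linarith
    have h1 := mul_le_mul_of_nonneg_right this h0
    linarith
  · rw [not_lt] at hw
    have h1 := regSource_le_rpow le_rfl (by norm_num) hε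
      (norm_pos_iff.1 (one_pos.trans_le hw))
    have h2 : ‖v - w‖ ^ ((-1 : ℝ) - 2) ≤ 1 :=
      Real.rpow_le_one_of_one_le_of_nonpos hw (by norm_num)
    have h3 : g w * regSource (-1) (regScale n) (v - w) ≤ g w * 3 := by
      gcongr
      linarith
    have := mul_nonneg hS0 h0
    linarith

theorem tendsto_source {γ : ℝ} (hγ : γ ∈ Ico (-3 : ℝ) (-2)) (hg : Continuous g)
    (hg0 : ∀ v, 0 ≤ g v) (hgi : Integrable g) (v : V) :
    Tendsto (fun n => ∫ w, g w * regSource (2 + γ) (regScale n) (v - w)) atTop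
      (𝓝 (-(2 + γ) * reactionCoeff γ g v)) := by
  by_cases h : γ = -3
  · subst h
    have := tendsto_integral_mul_regSource_coulomb hg hgi v
    norm_num [reactionCoeff]
    exact this
  · have h1 : -3 < γ := lt_of_le_of_ne hγ.1 (Ne.symm h)
    have := tendsto_integral_mul_regSource (p := 2 + γ) (by linarith) (by linarith [hγ.2]) hg hg0
      hgi v
    rw [reactionCoeff, if_neg h]
    refine tendsto_nhds_of_eq this ?_
    rw [show 2 + γ - 2 = γ by ring]
    ring

theorem exists_source_le {γ : ℝ} (hγ : γ ∈ Ico (-3 : ℝ) (-2)) (hg : Continuous g)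
    (hg0 : ∀ v, 0 ≤ g v) (hgi : Integrable g) (R : ℝ) :
    ∃ C, ∀ n, ∀ v ∈ Metric.closedBall (0 : V) R,
      ∫ w, g w * regSource (2 + γ) (regScale n) (v - w) ≤ C := by
  by_cases h : γ = -3
  · subst h
    have := exists_integral_mul_regSource_coulomb_le hg hg0 hgi R
    rwa [show (2 : ℝ) + -3 = -1 by norm_num]
  · have h1 : -3 < γ := lt_of_le_of_ne hγ.1 (Ne.symm h)
    exact exists_integral_mul_regSource_le (by linarith) (by linarith [hγ.2]) hg hg0 hgi R

/-- The regularized forms satisfy the bound with a constant independent of n and converge to the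
true one by dominated convergence on the support of φ. The Coulomb and non-Coulomb cases differ only
in the limit of the source. -/
theorem integral_mul_collision_le {γ : ℝ} (hγ : γ ∈ Ico (-3 : ℝ) (-2)) {φ L : V → ℝ}
    (hφ : ContDiff ℝ 2 φ) (hc : HasCompactSupport φ) (hg : ContDiff ℝ 2 g)
    (hg0 : ∀ v, 0 ≤ g v) (hgi : Integrable g) (hL : ∀ v, 0 ≤ L v)
    (hlap : ∀ v, Laplacian.laplacian φ v ≤ 3 * L v)
    (hgrad : ∀ v w, |fderiv ℝ φ v (v - w) - fderiv ℝ φ w (v - w)| ≤ (L v + L w) * ‖v - w‖ ^ 2)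
    (hgL : Integrable fun v => g v * L v) {A : ℝ}
    (hA : ∀ v, diffusionCoeff γ g v ≤ A) :
    ∫ v, φ v * collision γ g v ≤ 5 * (A * ∫ v, g v * L v) := by
  have hp1 : -1 ≤ 2 + γ := by linarith [hγ.1]
  have hp : 2 + γ < 0 := by linarith [hγ.2]
  have hKA : ∀ n v, ∫ w, g w * regKernel (2 + γ) (regScale n) (v - w) ≤ A := fun n v =>
    (integral_mul_regKernel_le hp1 hp (regScale_pos n) hg.continuous hg0 hgi v).trans (hA v)
  have hK0 : ∀ n v, 0 ≤ ∫ w, g w * regKernel (2 + γ) (regScale n) (v - w) := fun n v =>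
    integral_nonneg fun w => mul_nonneg (hg0 w) (regKernel_nonneg (regScale_pos n) _)
  have hS0 : ∀ n v, 0 ≤ ∫ w, g w * regSource (2 + γ) (regScale n) (v - w) := fun n v =>
    integral_nonneg fun w => mul_nonneg (hg0 w) (regSource_nonneg hp1 hp (regScale_pos n) _)
  obtain ⟨R, hR⟩ := hc.isCompact.isBounded.subset_closedBall (0 : V)
  obtain ⟨C, hC⟩ := exists_source_le hγ hg.continuous hg0 hgi R
  have i1 : Integrable fun v => φ v * Laplacian.laplacian g v :=
    (hφ.continuous.mul (continuous_laplacian hg)).integrable_of_hasCompactSupport hc.mul_right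
  have i2 : Integrable fun v => φ v * g v :=
    (hφ.continuous.mul hg.continuous).integrable_of_hasCompactSupport hc.mul_right
  have mK : ∀ n, StronglyMeasurable fun v =>
      ∫ w, g w * regKernel (2 + γ) (regScale n) (v - w) := fun n =>
    StronglyMeasurable.integral_prod_right (f := fun v w =>
      g w * regKernel (2 + γ) (regScale n) (v - w)) (((hg.continuous.comp continuous_snd).mul
        ((continuous_regKernel (regScale_pos n)).comp (by fun_prop))).stronglyMeasurable)
  have mS : ∀ n, StronglyMeasurable fun v =>
      ∫ w, g w * regSource (2 + γ) (regScale n) (v - w) := fun n =>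
    StronglyMeasurable.integral_prod_right (f := fun v w =>
      g w * regSource (2 + γ) (regScale n) (v - w)) (((hg.continuous.comp continuous_snd).mul
        ((continuous_regSource (regScale_pos n)).comp (by fun_prop))).stronglyMeasurable)
  have lim : Tendsto (fun n => ∫ v, (φ v * Laplacian.laplacian g v *
        (∫ w, g w * regKernel (2 + γ) (regScale n) (v - w)) +
        φ v * g v * ∫ w, g w * regSource (2 + γ) (regScale n) (v - w))) atTop
      (𝓝 (∫ v, φ v * collision γ g v)) := by
    refine tendsto_integral_of_dominated_convergence
      (fun v => |φ v * Laplacian.laplacian g v| * A + |φ v * g v| * C)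
      (fun n => (i1.aestronglyMeasurable.mul (mK n).aestronglyMeasurable).add
        (i2.aestronglyMeasurable.mul (mS n).aestronglyMeasurable))
      ((i1.abs.mul_const A).add (i2.abs.mul_const C)) (fun n => ae_of_all _ fun v => ?_)
      (ae_of_all _ fun v => ?_)
    · rw [Real.norm_eq_abs]
      refine (abs_add_le _ _).trans (add_le_add ?_ ?_)
      · rw [abs_mul, abs_of_nonneg (hK0 n v)]
        exact mul_le_mul_of_nonneg_left (hKA n v) (abs_nonneg _)
      · rw [abs_mul, abs_of_nonneg (hS0 n v)]
        by_cases hv : v ∈ tsupport φ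
        · exact mul_le_mul_of_nonneg_left (hC n v (hR hv)) (abs_nonneg _)
        · simp [image_eq_zero_of_notMem_tsupport hv]
    · have h1 := tendsto_integral_mul_regKernel hp1 hp hg.continuous hg0 hgi v
      have h2 := tendsto_source hγ hg.continuous hg0 hgi v
      refine tendsto_nhds_of_eq ((h1.const_mul (φ v * Laplacian.laplacian g v)).add
        (h2.const_mul (φ v * g v))) ?_
      rw [collision, diffusionCoeff]
      ring
  refine le_of_tendsto lim (Eventually.of_forall fun n => ?_)
  rw [integral_regularized_eq hp1 hp (regScale_pos n) hφ hc hg hgi]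
  exact integral_weakDensity_le hp1 hp (regScale_pos n) hφ hc hg0 hgi hL hlap hgrad hgL (hKA n)

end Limit

/-! ### Regularity of solutions and the tested equation -/

namespace IsClassicalSolution

variable {γ T : ℝ} {f : ℝ → V → ℝ}

theorem continuousOn (h : IsClassicalSolution γ T f) :
    ContinuousOn (fun p : ℝ × V => f p.1 p.2) (Ioc 0 T ×ˢ univ) := by
  have h0 := h.continuousOn_space 0 (by norm_num)
  have h1 : ContinuousOn (fun p : ℝ × V => iteratedFDeriv ℝ 0 (f p.1) p.2 0) (Ioc 0 T ×ˢ univ) :=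
    (ContinuousMultilinearMap.apply ℝ (fun _ : Fin 0 => V) ℝ 0).continuous.comp_continuousOn h0
  simpa only [iteratedFDeriv_zero_apply] using h1

/-- Through the equation, continuity of the nonlocal operator is read off from that of the time
derivative, with no study of the convolutions. -/
theorem continuousOn_collision (h : IsClassicalSolution γ T f) :
    ContinuousOn (fun p : ℝ × V => collision γ (f p.1) p.2) (Ioc 0 T ×ˢ univ) :=
  h.continuousOn_time.congr fun p hp =>
    ((h.equation p.1 hp.1 p.2).derivWithin (uniqueDiffOn_Ioc 0 T p.1 hp.1)).symm

theorem continuous_slice (h : IsClassicalSolution γ T f) {t : ℝ} (ht : t ∈ Ioc 0 T) :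
    Continuous (f t) := (h.contDiff t ht).continuous

theorem continuous_collision (h : IsClassicalSolution γ T f) {t : ℝ} (ht : t ∈ Ioc 0 T) :
    Continuous (collision γ (f t)) := by
  have h1 := h.continuousOn_collision.comp (f := fun v : V => (t, v)) (s := univ)
    (by fun_prop) (fun v _ => ⟨ht, mem_univ _⟩)
  exact continuousOn_univ.1 h1

theorem continuousOn_slice (h : IsClassicalSolution γ T f) (v : V) :
    ContinuousOn (fun t => f t v) (Ioc 0 T) :=
  h.continuousOn.comp (f := fun t => (t, v)) (by fun_prop) (fun _ ht => ⟨ht, mem_univ _⟩)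

/-- The essential supremum controls only almost every time. Every t > 0 is reached by Fatou along
good times converging to t, since f is continuous there. -/
theorem eLpNorm_le (h : IsClassicalSolution γ T f) {t : ℝ} (ht : t ∈ Ioc 0 T) :
    eLpNorm (f t) 3 volume ≤ normLinftyL3 T f := by
  have hae : ∀ᵐ τ ∂(volume.restrict (Icc 0 T)), eLpNorm (f τ) 3 volume ≤ normLinftyL3 T f :=
    ENNReal.ae_le_essSup _
  -- Approach from the left, in intervals contained in (0, t), so that t = T is included and τ stays
  -- positive.
  have hex : ∀ n : ℕ, ∃ τ ∈ Ioo (t - t / (n + 1)) t,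
      eLpNorm (f τ) 3 volume ≤ normLinftyL3 T f := by
    intro n
    have h1 : t / (n + 1) ≤ t := div_le_self ht.1.le (by linarith [n.cast_nonneg (α := ℝ)])
    have h2 : 0 < t / (n + 1) := div_pos ht.1 (by positivity)
    have hsub : Ioo (t - t / (n + 1)) t ⊆ Icc 0 T := fun τ hτ =>
      ⟨by linarith [hτ.1], hτ.2.le.trans ht.2⟩
    have hae' := ae_mono (Measure.restrict_mono hsub le_rfl) hae
    have hne : (volume.restrict (Ioo (t - t / (n + 1)) t)) ≠ 0 := by
      rw [Ne, Measure.restrict_eq_zero, Real.volume_Ioo]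
      simp [h2]
    have : NeBot (ae (volume.restrict (Ioo (t - t / (n + 1)) t))) := ae_neBot.2 hne
    obtain ⟨τ, h3, h4⟩ := ((ae_restrict_mem measurableSet_Ioo).and hae').exists
    exact ⟨τ, h3, h4⟩
  choose τ hτ hle using hex
  have hτ0 : ∀ n, τ n ∈ Ioc 0 T := fun n => by
    have h1 : t / (n + 1) ≤ t := div_le_self ht.1.le (by linarith [n.cast_nonneg (α := ℝ)])
    exact ⟨by linarith [(hτ n).1], (hτ n).2.le.trans ht.2⟩
  have hlim : Tendsto τ atTop (𝓝[Ioc 0 T] t) := by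
    refine tendsto_nhdsWithin_iff.2 ⟨?_, Eventually.of_forall hτ0⟩
    refine tendsto_of_tendsto_of_tendsto_of_le_of_le ?_ tendsto_const_nhds
      (fun n => (hτ n).1.le) (fun n => (hτ n).2.le)
    have := (tendsto_one_div_add_atTop_nhds_zero_nat (𝕜 := ℝ)).const_mul t
    have h2 := (tendsto_const_nhds (x := t)).sub this
    simp only [mul_zero, sub_zero] at h2
    refine h2.congr fun n => ?_
    ring
  have hpt : ∀ v, Tendsto (fun n => f (τ n) v) atTop (𝓝 (f t v)) := fun v =>
    (h.continuousOn_slice v t ht).tendsto.comp hlim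
  refine (Lp.eLpNorm_lim_le_liminf_eLpNorm
    (fun n => (h.continuous_slice (hτ0 n)).aestronglyMeasurable) (f t) (ae_of_all _ hpt)).trans ?_
  exact (liminf_le_liminf (Eventually.of_forall hle)).trans (by simp)

theorem integrable_cube (h : IsClassicalSolution γ T f) (hK : normLinftyL3 T f < ∞) {t : ℝ}
    (ht : t ∈ Ioc 0 T) :
    Integrable (fun v => f t v ^ 3) ∧ ∫ v, f t v ^ 3 ≤ (normLinftyL3 T f).toReal ^ 3 := by
  have h0 : ∀ v, 0 ≤ f t v := h.nonneg t (Ioc_subset_Icc_self ht)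
  have hle := h.eLpNorm_le ht
  have hm : MemLp (f t) ((3 : ℕ) : ℝ≥0∞) volume :=
    ⟨(h.continuous_slice ht).aestronglyMeasurable, by exact_mod_cast hle.trans_lt hK⟩
  have hi := hm.integrable_norm_pow (by norm_num)
  have e : (fun v => ‖f t v‖ ^ 3) = fun v => f t v ^ 3 :=
    funext fun v => by rw [Real.norm_of_nonneg (h0 v)]
  rw [e] at hi
  refine ⟨hi, ?_⟩
  have pw : ∀ x : ℝ≥0∞, x ^ (((3 : ℝ≥0)) : ℝ) = x ^ 3 := fun x => by
    rw [← ENNReal.rpow_natCast]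
    norm_num
  have h1 := eLpNorm_nnreal_pow_eq_lintegral (f := f t) (μ := volume) (p := 3) (by norm_num)
  have h2 : ∫ v, f t v ^ 3 = (∫⁻ v, ‖f t v‖ₑ ^ (((3 : ℝ≥0)) : ℝ)).toReal := by
    rw [integral_eq_lintegral_of_nonneg_ae (ae_of_all _ fun v => pow_nonneg (h0 v) 3)
      hi.aestronglyMeasurable]
    congr 1
    refine lintegral_congr fun v => ?_
    rw [Real.enorm_of_nonneg (h0 v), ENNReal.ofReal_pow (h0 v), pw]
  rw [h2, ← h1]
  have e3 : (((3 : ℝ≥0)) : ℝ≥0∞) = 3 := by norm_cast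
  rw [e3, pw, ENNReal.toReal_pow]
  gcongr
  exact hK.ne

theorem diffusionCoeff_le (h : IsClassicalSolution γ T f) (hγ : γ ∈ Ico (-3 : ℝ) (-2))
    (hK : normLinftyL3 T f < ∞) {t : ℝ} (ht : t ∈ Ioc 0 T) (v : V) :
    diffusionCoeff γ (f t) v ≤
      (∫ w, f t w) + (normLinftyL3 T f).toReal ^ 3 + ballConst := by
  obtain ⟨h3, hle⟩ := h.integrable_cube hK ht
  have := diffusion_le (p := 2 + γ) (by linarith [hγ.1]) (by linarith [hγ.2])
    (h.continuous_slice ht) (h.nonneg t (Ioc_subset_Icc_self ht))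
    (h.integrable t (Ioc_subset_Icc_self ht)) h3 v
  rw [diffusionCoeff]
  linarith

theorem continuousOn_integral_mul (h : IsClassicalSolution γ T f) {φ : V → ℝ}
    (hφ : Continuous φ) (hc : HasCompactSupport φ) :
    ContinuousOn (fun t => ∫ v, f t v * φ v) (Ioc 0 T) := by
  refine continuousOn_integral_of_compact_support hc.isCompact
    (f := fun t v => f t v * φ v) ?_ fun t v _ hv => ?_
  · exact h.continuousOn.mul (hφ.comp continuous_snd).continuousOn
  · rw [image_eq_zero_of_notMem_tsupport hv, mul_zero]

theorem hasDerivAt_integral_mul (h : IsClassicalSolution γ T f) {φ : V → ℝ}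
    (hφ : Continuous φ) (hc : HasCompactSupport φ) {t : ℝ} (ht : t ∈ Ioo 0 T) :
    HasDerivAt (fun t => ∫ v, f t v * φ v) (∫ v, φ v * collision γ (f t) v) t := by
  -- A compact time interval away from 0, where nothing is known about derivatives; times the
  -- support of φ, it carries a uniform bound on the integrand.
  have hsub : Icc (t / 2) T ⊆ Ioc 0 T := fun τ hτ => ⟨by linarith [hτ.1, ht.1], hτ.2⟩
  have hs : Ioo (t / 2) T ∈ 𝓝 t := Ioo_mem_nhds (by linarith [ht.1]) ht.2
  have hsub2 : Ioo (t / 2) T ⊆ Ioc 0 T := Ioo_subset_Icc_self.trans hsub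
  have hcont : ContinuousOn (fun p : ℝ × V => φ p.2 * collision γ (f p.1) p.2)
      (Ioc 0 T ×ˢ univ) :=
    (hφ.comp continuous_snd).continuousOn.mul h.continuousOn_collision
  obtain ⟨C, hC⟩ := (isCompact_Icc.prod hc.isCompact).exists_bound_of_continuousOn
    (hcont.mono (prod_mono hsub (subset_univ (tsupport φ))))
  have htT : t ∈ Ioc 0 T := ⟨ht.1, ht.2.le⟩
  refine (hasDerivAt_integral_of_dominated_loc_of_deriv_le
    (bound := (tsupport φ).indicator fun _ => C)
    (F' := fun t v => φ v * collision γ (f t) v) hs ?_ ?_ ?_ ?_ ?_ ?_).2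
  · filter_upwards [hs] with τ hτ
    exact ((h.continuous_slice (hsub2 hτ)).mul hφ).aestronglyMeasurable
  · exact ((h.continuous_slice htT).mul hφ).integrable_of_hasCompactSupport hc.mul_left
  · exact (hφ.mul (h.continuous_collision htT)).aestronglyMeasurable
  · refine ae_of_all _ fun v τ hτ => ?_
    by_cases hv : v ∈ tsupport φ
    · rw [indicator_of_mem hv]
      exact hC (τ, v) ⟨Ioo_subset_Icc_self hτ, hv⟩
    · rw [indicator_of_notMem hv, image_eq_zero_of_notMem_tsupport hv, zero_mul, norm_zero]
  · rw [integrable_indicator_iff (isClosed_tsupport φ).measurableSet]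
    exact integrableOn_const hc.isCompact.measure_ne_top
  · refine ae_of_all _ fun v τ hτ => ?_
    have h1 := (h.equation τ (hsub2 hτ) v).hasDerivAt
      (Filter.mem_of_superset (Ioo_mem_nhds hτ.1 hτ.2) hsub2)
    have h2 := h1.mul_const (φ v)
    rwa [mul_comm] at h2

/-- The weak inequality obtained by testing the equation against `φ`. -/
theorem integral_mul_le (h : IsClassicalSolution γ T f) (hγ : γ ∈ Ico (-3 : ℝ) (-2))
    {φ L : V → ℝ} (hφ : ContDiff ℝ 2 φ) (hc : HasCompactSupport φ) (hL : ∀ v, 0 ≤ L v)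
    (hlap : ∀ v, Laplacian.laplacian φ v ≤ 3 * L v)
    (hgrad : ∀ v w, |fderiv ℝ φ v (v - w) - fderiv ℝ φ w (v - w)| ≤ (L v + L w) * ‖v - w‖ ^ 2)
    {A B t : ℝ} (hA0 : 0 ≤ A) (ht : t ∈ Ioc 0 T)
    (hA : ∀ τ ∈ Ioc 0 t, ∀ v, diffusionCoeff γ (f τ) v ≤ A)
    (hfL : ∀ τ ∈ Ioc 0 t, Integrable fun v => f τ v * L v)
    (hB : ∀ τ ∈ Ioc 0 t, ∫ v, f τ v * L v ≤ B) :
    ∫ v, f t v * φ v ≤ (∫ v, f 0 v * φ v) + 5 * A * B * t := by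
  set y : ℝ → ℝ := fun t => ∫ v, f t v * φ v with hy
  have key : ∀ t1 ∈ Ioo 0 t, y t ≤ y t1 + 5 * A * B * (t - t1) := by
    intro t1 ht1
    have hsub : Icc t1 t ⊆ Ioc 0 T := fun τ hτ => ⟨ht1.1.trans_le hτ.1, hτ.2.trans ht.2⟩
    have hd : ∀ τ ∈ Ioo t1 t, HasDerivAt (fun τ => y τ - 5 * A * B * τ)
        ((∫ v, φ v * collision γ (f τ) v) - 5 * A * B) τ := by
      intro τ hτ
      have h1 := h.hasDerivAt_integral_mul hφ.continuous hc
        (t := τ) ⟨ht1.1.trans hτ.1, hτ.2.trans_le ht.2⟩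
      have h2 := (hasDerivAt_id τ).const_mul (5 * A * B)
      rw [mul_one] at h2
      exact h1.sub h2
    have hanti : AntitoneOn (fun τ => y τ - 5 * A * B * τ) (Icc t1 t) := by
      refine antitoneOn_of_deriv_nonpos (convex_Icc _ _) ?_ ?_ ?_
      · exact ((h.continuousOn_integral_mul hφ.continuous hc).mono hsub).sub (by fun_prop)
      · rw [interior_Icc]
        exact fun τ hτ => (hd τ hτ).differentiableAt.differentiableWithinAt
      · rw [interior_Icc]
        intro τ hτ
        rw [(hd τ hτ).deriv]
        have hτ' : τ ∈ Ioc 0 t := ⟨ht1.1.trans hτ.1, hτ.2.le⟩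
        have hτT : τ ∈ Ioc 0 T := ⟨hτ'.1, hτ'.2.trans ht.2⟩
        have h1 := integral_mul_collision_le hγ hφ hc (h.contDiff τ hτT)
          (h.nonneg τ (Ioc_subset_Icc_self hτT)) (h.integrable τ (Ioc_subset_Icc_self hτT))
          hL hlap hgrad (hfL τ hτ') (hA τ hτ')
        have h2 := mul_le_mul_of_nonneg_left (hB τ hτ') hA0
        linarith
    have := hanti (left_mem_Icc.2 ht1.2.le) (right_mem_Icc.2 ht1.2.le) ht1.2.le
    simp only at this
    linarith
  -- Time 0 is reached only through the weak initial condition, which applies because φ has compact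
  -- support.
  have hlim : Tendsto (fun t1 => y t1 + 5 * A * B * (t - t1)) (𝓝[>] 0)
      (𝓝 (y 0 + 5 * A * B * (t - 0))) := by
    refine (h.initial φ hφ.continuous hc).add ?_
    have : Tendsto (fun t1 : ℝ => 5 * A * B * (t - t1)) (𝓝 0) (𝓝 (5 * A * B * (t - 0))) :=
      Continuous.tendsto (by fun_prop) 0
    exact this.mono_left nhdsWithin_le_nhds
  have := ge_of_tendsto hlim (by
    filter_upwards [Ioo_mem_nhdsGT ht.1] with t1 ht1 using key t1 ht1)
  rwa [sub_zero] at this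

end IsClassicalSolution

/-! ### Truncated radial weights -/

section TestFunctions

/-- Mean value theorem along the segment from w to v. The Hessian of H(|u|²) is 2H' I + 4H'' u⊗u, of
norm at most l(|u|²). As |u| ≤ max(|v|, |w|) on the segment, monotonicity of l bounds this by the
two endpoint values. -/
theorem abs_fderiv_radial_sub_le {H H' H'' : ℝ → ℝ} (hH : ∀ x, 0 ≤ x → HasDerivAt H (H' x) x)
    (hH' : ∀ x, 0 ≤ x → HasDerivAt H' (H'' x) x) {l : ℝ → ℝ} (hl : MonotoneOn l (Ici 0))
    (hl0 : ∀ x, 0 ≤ x → 0 ≤ l x)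
    (hb : ∀ x, 0 ≤ x → 2 * |H' x| + 4 * x * |H'' x| ≤ l x) (v w : V) :
    |fderiv ℝ (fun v => H (‖v‖ ^ 2)) v (v - w) - fderiv ℝ (fun v => H (‖v‖ ^ 2)) w (v - w)| ≤
      (l (‖v‖ ^ 2) + l (‖w‖ ^ 2)) * ‖v - w‖ ^ 2 := by
  set z := v - w with hz
  have hfd : ∀ u : V, fderiv ℝ (fun v => H (‖v‖ ^ 2)) u z = 2 * H' (‖u‖ ^ 2) * ⟪u, z⟫_ℝ := by
    intro u
    have := hasFDerivAt_radial hH 0 u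
    simp only [sub_zero] at this
    rw [this.fderiv]
    rfl
  have hd : ∀ θ : ℝ, HasDerivAt (fun θ : ℝ => 2 * H' (‖w + θ • z‖ ^ 2) * ⟪w + θ • z, z⟫_ℝ)
      (2 * (H'' (‖w + θ • z‖ ^ 2) * (2 * ⟪w + θ • z, z⟫_ℝ)) * ⟪w + θ • z, z⟫_ℝ +
        2 * H' (‖w + θ • z‖ ^ 2) * ‖z‖ ^ 2) θ := by
    intro θ
    have hu : HasDerivAt (fun θ : ℝ => w + θ • z) z θ := by
      have := ((hasDerivAt_id θ).smul_const z).const_add w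
      simpa using this
    have h1 := (hH' _ (sq_nonneg ‖w + θ • z‖)).comp θ hu.norm_sq
    have h2 : HasDerivAt (fun θ : ℝ => ⟪w + θ • z, z⟫_ℝ) (‖z‖ ^ 2) θ := by
      have := hu.inner ℝ (hasDerivAt_const θ z)
      simpa using this
    exact (h1.const_mul 2).mul h2
  have hbound : ∀ θ ∈ Ico (0 : ℝ) 1,
      ‖2 * (H'' (‖w + θ • z‖ ^ 2) * (2 * ⟪w + θ • z, z⟫_ℝ)) * ⟪w + θ • z, z⟫_ℝ +
        2 * H' (‖w + θ • z‖ ^ 2) * ‖z‖ ^ 2‖ ≤ (l (‖v‖ ^ 2) + l (‖w‖ ^ 2)) * ‖z‖ ^ 2 := by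
    intro θ hθ
    set u := w + θ • z with hu
    have hux : ‖u‖ ≤ max ‖v‖ ‖w‖ := by
      have e : u = θ • v + (1 - θ) • w := by rw [hu, hz]; module
      rw [e]
      refine (norm_add_le _ _).trans ?_
      rw [norm_smul, norm_smul, Real.norm_of_nonneg hθ.1, Real.norm_of_nonneg (by linarith [hθ.2])]
      nlinarith [le_max_left ‖v‖ ‖w‖, le_max_right ‖v‖ ‖w‖, hθ.1, hθ.2]
    have hlu : l (‖u‖ ^ 2) ≤ l (‖v‖ ^ 2) + l (‖w‖ ^ 2) := by
      have hv0 := hl0 _ (sq_nonneg ‖v‖)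
      have hw0 := hl0 _ (sq_nonneg ‖w‖)
      rcases le_max_iff.1 hux with h | h
      · have := hl (sq_nonneg ‖u‖) (sq_nonneg ‖v‖)
          (pow_le_pow_left₀ (norm_nonneg _) h 2)
        linarith
      · have := hl (sq_nonneg ‖u‖) (sq_nonneg ‖w‖)
          (pow_le_pow_left₀ (norm_nonneg _) h 2)
        linarith
    have hin : ⟪u, z⟫_ℝ ^ 2 ≤ ‖u‖ ^ 2 * ‖z‖ ^ 2 := by
      rw [← mul_pow, ← sq_abs]
      exact pow_le_pow_left₀ (abs_nonneg _) (abs_real_inner_le_norm u z) 2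
    have h1 := hb _ (sq_nonneg ‖u‖)
    calc _ ≤ 4 * |H'' (‖u‖ ^ 2)| * ⟪u, z⟫_ℝ ^ 2 + 2 * |H' (‖u‖ ^ 2)| * ‖z‖ ^ 2 := by
          rw [Real.norm_eq_abs]
          refine (abs_add_le _ _).trans (le_of_eq ?_)
          rw [show 2 * (H'' (‖u‖ ^ 2) * (2 * ⟪u, z⟫_ℝ)) * ⟪u, z⟫_ℝ =
            4 * H'' (‖u‖ ^ 2) * ⟪u, z⟫_ℝ ^ 2 by ring]
          simp [abs_mul]
      _ ≤ 4 * |H'' (‖u‖ ^ 2)| * (‖u‖ ^ 2 * ‖z‖ ^ 2) + 2 * |H' (‖u‖ ^ 2)| * ‖z‖ ^ 2 := by gcongr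
      _ = (2 * |H' (‖u‖ ^ 2)| + 4 * ‖u‖ ^ 2 * |H'' (‖u‖ ^ 2)|) * ‖z‖ ^ 2 := by ring
      _ ≤ _ := mul_le_mul_of_nonneg_right (h1.trans hlu) (sq_nonneg _)
  have := norm_image_sub_le_of_norm_deriv_le_segment_01' (fun θ _ => (hd θ).hasDerivWithinAt) hbound
  rw [Real.norm_eq_abs] at this
  simp only [one_smul, zero_smul, add_zero] at this
  rw [hfd, hfd]
  convert this using 4 <;> rw [hz] <;> simp

theorem laplacian_radial_le {H H' H'' : ℝ → ℝ} (hH : ∀ x, 0 ≤ x → HasDerivAt H (H' x) x)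
    (hH' : ∀ x, 0 ≤ x → HasDerivAt H' (H'' x) x) {l : ℝ → ℝ}
    (hb : ∀ x, 0 ≤ x → 2 * |H' x| + 4 * x * |H'' x| ≤ l x)
    (hC : ContDiff ℝ 2 fun v : V => H (‖v‖ ^ 2)) (v : V) :
    Laplacian.laplacian (fun v : V => H (‖v‖ ^ 2)) v ≤ 3 * l (‖v‖ ^ 2) := by
  have h := laplacian_radial (EuclideanSpace.basisFun (Fin 3) ℝ) hH hH' 0
    (by simpa only [sub_zero] using hC) v
  simp only [sub_zero, Fintype.card_fin] at h
  rw [h]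
  have h1 := hb _ (sq_nonneg ‖v‖)
  have h2 : H' (‖v‖ ^ 2) ≤ |H' (‖v‖ ^ 2)| := le_abs_self _
  have h3 : ‖v‖ ^ 2 * H'' (‖v‖ ^ 2) ≤ ‖v‖ ^ 2 * |H'' (‖v‖ ^ 2)| :=
    mul_le_mul_of_nonneg_left (le_abs_self _) (sq_nonneg _)
  have h4 : 0 ≤ ‖v‖ ^ 2 * |H'' (‖v‖ ^ 2)| := by positivity
  push_cast
  linarith

/-- A smooth cutoff, equal to `1` on `(-∞, 1]` and to `0` on `[2, ∞)`. -/
noncomputable def cutoff (u : ℝ) : ℝ := Real.smoothTransition (2 - u)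

theorem contDiff_cutoff {n : ℕ∞} : ContDiff ℝ n cutoff :=
  Real.smoothTransition.contDiff.comp (contDiff_const.sub contDiff_id)

theorem cutoff_nonneg (u : ℝ) : 0 ≤ cutoff u := Real.smoothTransition.nonneg _

theorem cutoff_le_one (u : ℝ) : cutoff u ≤ 1 := Real.smoothTransition.le_one _

theorem cutoff_of_le {u : ℝ} (hu : u ≤ 1) : cutoff u = 1 :=
  Real.smoothTransition.one_of_one_le (by linarith)

theorem cutoff_of_ge {u : ℝ} (hu : 2 ≤ u) : cutoff u = 0 :=
  Real.smoothTransition.zero_of_nonpos (by linarith)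

theorem hasDerivAt_cutoff (u : ℝ) : HasDerivAt cutoff (deriv cutoff u) u :=
  ((contDiff_cutoff (n := 1)).differentiable (by norm_num) u).hasDerivAt

theorem contDiff_deriv_cutoff : ContDiff ℝ 1 (deriv cutoff) :=
  ((contDiff_succ_iff_deriv (n := 1)).1 (contDiff_cutoff (n := 2))).2.2

theorem hasDerivAt_deriv_cutoff (u : ℝ) :
    HasDerivAt (deriv cutoff) (deriv (deriv cutoff) u) u :=
  (contDiff_deriv_cutoff.differentiable (by norm_num) u).hasDerivAt

theorem exists_abs_le_of_eq_zero {k : ℝ → ℝ} (hk : Continuous k) (h0 : ∀ u, 2 < u → k u = 0) :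
    ∃ C, 0 ≤ C ∧ ∀ u, 0 ≤ u → |k u| ≤ C := by
  obtain ⟨C, hC⟩ := isCompact_Icc.exists_bound_of_continuousOn (hk.continuousOn (s := Icc 0 2))
  have hC0 : 0 ≤ C := (norm_nonneg _).trans (hC 0 (by simp))
  refine ⟨C, hC0, fun u hu => ?_⟩
  rcases le_or_gt u 2 with h | h
  · exact hC u ⟨hu, h⟩
  · rw [h0 u h, abs_zero]
    exact hC0

/-- The second and fourth bounds are scale invariant and give estimates uniform in the truncation;
the first and third leave one factor c and make the error vanish for the mass. -/
theorem exists_cutoff_deriv_bound : ∃ C, 0 ≤ C ∧ ∀ u, 0 ≤ u →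
    |deriv cutoff u| ≤ C ∧ |u * deriv cutoff u| ≤ C ∧ |u * deriv (deriv cutoff) u| ≤ C ∧
      |u ^ 2 * deriv (deriv cutoff) u| ≤ C := by
  have z1 : ∀ u, 2 < u → deriv cutoff u = 0 := fun u hu => by
    have : cutoff =ᶠ[𝓝 u] fun _ => 0 := by
      filter_upwards [lt_mem_nhds hu] with x hx using cutoff_of_ge hx.le
    rw [this.deriv_eq, deriv_const]
  have z2 : ∀ u, 2 < u → deriv (deriv cutoff) u = 0 := fun u hu => by
    have : deriv cutoff =ᶠ[𝓝 u] fun _ => 0 := by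
      filter_upwards [lt_mem_nhds hu] with x hx using z1 x hx
    rw [this.deriv_eq, deriv_const]
  have c1 : Continuous (deriv cutoff) := contDiff_deriv_cutoff.continuous
  have c2 : Continuous (deriv (deriv cutoff)) := contDiff_deriv_cutoff.continuous_deriv (by norm_num)
  obtain ⟨C1, p1, h1⟩ := exists_abs_le_of_eq_zero c1 z1
  obtain ⟨C2, p2, h2⟩ := exists_abs_le_of_eq_zero (k := fun u => u * deriv cutoff u)
    (by fun_prop) fun u hu => by simp [z1 u hu]
  obtain ⟨C3, p3, h3⟩ := exists_abs_le_of_eq_zero (k := fun u => u * deriv (deriv cutoff) u)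
    (by fun_prop) fun u hu => by simp [z2 u hu]
  obtain ⟨C4, p4, h4⟩ := exists_abs_le_of_eq_zero (k := fun u => u ^ 2 * deriv (deriv cutoff) u)
    (by fun_prop) fun u hu => by simp [z2 u hu]
  refine ⟨C1 + C2 + C3 + C4, by positivity, fun u hu => ⟨?_, ?_, ?_, ?_⟩⟩
  · linarith [h1 u hu]
  · linarith [h2 u hu]
  · linarith [h3 u hu]
  · linarith [h4 u hu]

/-- The radial profile `(1 + x)^σ` truncated at scale `1/c`. -/
noncomputable def profile (σ c x : ℝ) : ℝ := (1 + x) ^ σ * cutoff (c * (1 + x))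

/-- The first derivative of `profile σ c`. -/
noncomputable def profileDeriv (σ c x : ℝ) : ℝ :=
  (1 + x) ^ (σ - 1) * (σ * cutoff (c * (1 + x))) + (1 + x) ^ σ * (c * deriv cutoff (c * (1 + x)))

/-- The second derivative of `profile σ c`. -/
noncomputable def profileDeriv2 (σ c x : ℝ) : ℝ :=
  (1 + x) ^ (σ - 2) * (σ * (σ - 1) * cutoff (c * (1 + x))) +
    (1 + x) ^ (σ - 1) * (2 * σ * (c * deriv cutoff (c * (1 + x)))) +
      (1 + x) ^ σ * (c ^ 2 * deriv (deriv cutoff) (c * (1 + x)))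

theorem hasDerivAt_one_add_rpow (q : ℝ) {x : ℝ} (hx : 0 ≤ x) :
    HasDerivAt (fun x => (1 + x) ^ q) (q * (1 + x) ^ (q - 1)) x := by
  have := ((hasDerivAt_id x).const_add 1).rpow_const (p := q) (Or.inl (by positivity))
  simpa using this

theorem hasDerivAt_mul_one_add (c x : ℝ) : HasDerivAt (fun x => c * (1 + x)) c x := by
  have := ((hasDerivAt_id x).const_add 1).const_mul c
  simpa using this

theorem hasDerivAt_profile (σ c : ℝ) {x : ℝ} (hx : 0 ≤ x) :
    HasDerivAt (profile σ c) (profileDeriv σ c x) x := by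
  have h := (hasDerivAt_one_add_rpow σ hx).mul
    ((hasDerivAt_cutoff (c * (1 + x))).comp x (hasDerivAt_mul_one_add c x))
  refine h.congr_deriv ?_
  simp only [profileDeriv, Function.comp_apply]
  ring

theorem hasDerivAt_profileDeriv (σ c : ℝ) {x : ℝ} (hx : 0 ≤ x) :
    HasDerivAt (profileDeriv σ c) (profileDeriv2 σ c x) x := by
  have h1 := (hasDerivAt_one_add_rpow (σ - 1) hx).mul
    (((hasDerivAt_cutoff (c * (1 + x))).comp x (hasDerivAt_mul_one_add c x)).const_mul σ)
  have h2 := (hasDerivAt_one_add_rpow σ hx).mul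
    (((hasDerivAt_deriv_cutoff (c * (1 + x))).comp x (hasDerivAt_mul_one_add c x)).const_mul c)
  refine (h1.add h2).congr_deriv ?_
  simp only [profileDeriv2, Function.comp_apply]
  rw [show σ - 1 - 1 = σ - 2 by ring]
  ring

/-- With u = c(1+x), each factor c from differentiating the cutoff is u/(1+x), so it costs a power
of 1+x just like differentiating the weight. The exponent is cut at 0 to make the majorant monotone.
-/
theorem exists_profile_bound {σ : ℝ} (hσ : 0 ≤ σ) : ∃ D, 0 < D ∧ ∀ c, 0 < c → ∀ x, 0 ≤ x →
    2 * |profileDeriv σ c x| + 4 * x * |profileDeriv2 σ c x| ≤ D * (1 + x) ^ max (σ - 1) 0 := by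
  obtain ⟨C, hC0, hC⟩ := exists_cutoff_deriv_bound
  refine ⟨2 * (σ + C) + 4 * (|σ * (σ - 1)| + 2 * σ * C + C) + 1, by positivity,
    fun c hc x hx => ?_⟩
  have hy : 0 < 1 + x := by positivity
  obtain ⟨-, b1, -, b2⟩ := hC (c * (1 + x)) (by positivity)
  have e1 : (1 + x) ^ σ = (1 + x) ^ (σ - 1) * (1 + x) := by
    rw [← Real.rpow_add_one hy.ne']; congr 1; ring
  have e2 : (1 + x) ^ (σ - 1) = (1 + x) ^ (σ - 2) * (1 + x) := by
    rw [← Real.rpow_add_one hy.ne']; congr 1; ring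
  set χ := cutoff (c * (1 + x))
  set χ1 := deriv cutoff (c * (1 + x))
  set χ2 := deriv (deriv cutoff) (c * (1 + x))
  have hχ : |χ| ≤ 1 := by
    rw [abs_of_nonneg (cutoff_nonneg _)]; exact cutoff_le_one _
  have r1 := Real.rpow_nonneg hy.le (σ - 1)
  have r2 := Real.rpow_nonneg hy.le (σ - 2)
  have d1 : |profileDeriv σ c x| ≤ (1 + x) ^ (σ - 1) * (σ + C) := by
    have : profileDeriv σ c x = (1 + x) ^ (σ - 1) * (σ * χ + c * (1 + x) * χ1) := by
      rw [profileDeriv, e1]; ring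
    rw [this, abs_mul, abs_of_nonneg r1]
    refine mul_le_mul_of_nonneg_left ((abs_add_le _ _).trans (add_le_add ?_ b1)) r1
    rw [abs_mul, abs_of_nonneg hσ]
    exact mul_le_of_le_one_right hσ hχ
  have d2 : |profileDeriv2 σ c x| ≤
      (1 + x) ^ (σ - 2) * (|σ * (σ - 1)| + 2 * σ * C + C) := by
    have : profileDeriv2 σ c x = (1 + x) ^ (σ - 2) * (σ * (σ - 1) * χ +
        2 * σ * (c * (1 + x) * χ1) + (c * (1 + x)) ^ 2 * χ2) := by
      rw [profileDeriv2, e1, e2]; ring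
    rw [this, abs_mul, abs_of_nonneg r2]
    refine mul_le_mul_of_nonneg_left ((abs_add_le _ _).trans (add_le_add
      ((abs_add_le _ _).trans (add_le_add ?_ ?_)) b2)) r2
    · rw [abs_mul]
      exact mul_le_of_le_one_right (abs_nonneg _) hχ
    · rw [abs_mul, abs_of_nonneg (by positivity : 0 ≤ 2 * σ)]
      gcongr
  have r3 : (1 + x) ^ (σ - 1) ≤ (1 + x) ^ max (σ - 1) 0 :=
    Real.rpow_le_rpow_of_exponent_le (by linarith) (le_max_left _ _)
  have hE : 0 ≤ |σ * (σ - 1)| + 2 * σ * C + C := by positivity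
  have hE1 : 0 ≤ σ + C := by positivity
  have r4 : x * (1 + x) ^ (σ - 2) ≤ (1 + x) ^ (σ - 1) := by rw [e2]; nlinarith
  calc 2 * |profileDeriv σ c x| + 4 * x * |profileDeriv2 σ c x|
      ≤ 2 * ((1 + x) ^ (σ - 1) * (σ + C)) +
        4 * x * ((1 + x) ^ (σ - 2) * (|σ * (σ - 1)| + 2 * σ * C + C)) := by gcongr
    _ = 2 * ((1 + x) ^ (σ - 1) * (σ + C)) +
        4 * (x * (1 + x) ^ (σ - 2)) * (|σ * (σ - 1)| + 2 * σ * C + C) := by ring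
    _ ≤ 2 * ((1 + x) ^ (σ - 1) * (σ + C)) +
        4 * (1 + x) ^ (σ - 1) * (|σ * (σ - 1)| + 2 * σ * C + C) := by gcongr
    _ = (2 * (σ + C) + 4 * (|σ * (σ - 1)| + 2 * σ * C + C)) * (1 + x) ^ (σ - 1) := by ring
    _ ≤ (2 * (σ + C) + 4 * (|σ * (σ - 1)| + 2 * σ * C + C) + 1) * (1 + x) ^ max (σ - 1) 0 :=
        mul_le_mul (by linarith) r3 r1 (by positivity)

/-- For σ = 0 only derivatives of the cutoff survive, so a factor c remains and the bound tends to 0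
as the truncation is removed. -/
theorem exists_profile_zero_bound : ∃ D, 0 < D ∧ ∀ c, 0 < c → ∀ x, 0 ≤ x →
    2 * |profileDeriv 0 c x| + 4 * x * |profileDeriv2 0 c x| ≤ D * c := by
  obtain ⟨C, hC0, hC⟩ := exists_cutoff_deriv_bound
  refine ⟨6 * C + 1, by positivity, fun c hc x hx => ?_⟩
  obtain ⟨b1, -, b2, -⟩ := hC (c * (1 + x)) (by positivity)
  have e1 : |profileDeriv 0 c x| ≤ c * C := by
    simp only [profileDeriv, zero_mul, mul_zero, zero_add, Real.rpow_zero, one_mul]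
    rw [abs_mul, abs_of_pos hc]
    gcongr
  have e2 : x * |profileDeriv2 0 c x| ≤ c * C := by
    simp only [profileDeriv2, zero_mul, mul_zero, zero_add, Real.rpow_zero, one_mul]
    rw [abs_mul, abs_of_pos (by positivity : 0 < c ^ 2)]
    rw [abs_mul, abs_of_pos (by positivity : 0 < c * (1 + x))] at b2
    calc x * (c ^ 2 * |deriv (deriv cutoff) (c * (1 + x))|)
        ≤ (1 + x) * (c ^ 2 * |deriv (deriv cutoff) (c * (1 + x))|) := by gcongr; linarith
      _ = c * (c * (1 + x) * |deriv (deriv cutoff) (c * (1 + x))|) := by ring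
      _ ≤ c * C := by gcongr
  nlinarith

theorem contDiff_profile (σ c : ℝ) : ContDiff ℝ 2 fun v : V => profile σ c (‖v‖ ^ 2) := by
  have h : ContDiff ℝ 2 fun v : V => 1 + ‖v‖ ^ 2 := contDiff_const.add (contDiff_norm_sq ℝ)
  exact (h.rpow_const_of_ne fun v => by positivity).mul
    ((contDiff_cutoff (n := 2)).comp (contDiff_const.mul h))

theorem hasCompactSupport_profile (σ : ℝ) {c : ℝ} (hc : 0 < c) :
    HasCompactSupport fun v : V => profile σ c (‖v‖ ^ 2) := by
  refine HasCompactSupport.intro (isCompact_closedBall (0 : V) (2 / c + 1)) fun v hv => ?_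
  rw [mem_closedBall_zero_iff, not_le] at hv
  have h1 : 0 < 2 / c := by positivity
  have h2 : 2 / c ≤ 1 + ‖v‖ ^ 2 := by nlinarith
  rw [profile, cutoff_of_ge ((div_le_iff₀' hc).1 h2), mul_zero]

theorem profile_nonneg (σ c : ℝ) {x : ℝ} (hx : 0 ≤ x) : 0 ≤ profile σ c x :=
  mul_nonneg (Real.rpow_nonneg (by linarith) _) (cutoff_nonneg _)

theorem profile_le (σ c : ℝ) {x : ℝ} (hx : 0 ≤ x) : profile σ c x ≤ (1 + x) ^ σ :=
  mul_le_of_le_one_right (Real.rpow_nonneg (by linarith) _) (cutoff_le_one _)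

theorem tendsto_profile (σ x : ℝ) :
    Tendsto (fun n => profile σ (regScale n) x) atTop (𝓝 ((1 + x) ^ σ)) := by
  have h : Tendsto (fun n => regScale n * (1 + x)) atTop (𝓝 (0 * (1 + x))) :=
    tendsto_regScale.mul_const _
  rw [zero_mul] at h
  have h1 := ((contDiff_cutoff (n := 0)).continuous.tendsto 0).comp h
  rw [cutoff_of_le (by norm_num)] at h1
  have := h1.const_mul ((1 + x) ^ σ)
  rwa [mul_one] at this

end TestFunctions

/-! ### Smooth moments and decay of the mass -/

/-- The moment `∫ g(v) (1 + |v|²)^σ dv` with the smooth weight. -/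
noncomputable def smoothMoment (σ : ℝ) (g : V → ℝ) : ℝ≥0∞ :=
  ∫⁻ v, ENNReal.ofReal (g v * (1 + ‖v‖ ^ 2) ^ σ)

/-- Fatou's lemma removes the truncation without presupposing that the full moment is finite. -/
theorem smoothMoment_le_of_profile_le {σ : ℝ} {g : V → ℝ} (hg : AEMeasurable g) {b : ℕ → ℝ≥0∞}
    {b0 : ℝ≥0∞}
    (hb : ∀ n, ∫⁻ v, ENNReal.ofReal (g v * profile σ (regScale n) (‖v‖ ^ 2)) ≤ b n)
    (hlim : Tendsto b atTop (𝓝 b0)) : smoothMoment σ g ≤ b0 := by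
  have hpt : ∀ v, liminf (fun n => ENNReal.ofReal (g v * profile σ (regScale n) (‖v‖ ^ 2))) atTop =
      ENNReal.ofReal (g v * (1 + ‖v‖ ^ 2) ^ σ) := fun v =>
    (ENNReal.tendsto_ofReal ((tendsto_profile σ (‖v‖ ^ 2)).const_mul (g v))).liminf_eq
  calc smoothMoment σ g
      = ∫⁻ v, liminf (fun n => ENNReal.ofReal (g v * profile σ (regScale n) (‖v‖ ^ 2))) atTop :=
        lintegral_congr fun v => (hpt v).symm
    _ ≤ liminf (fun n => ∫⁻ v, ENNReal.ofReal (g v * profile σ (regScale n) (‖v‖ ^ 2))) atTop :=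
        lintegral_liminf_le' fun n =>
          (hg.mul (contDiff_profile σ (regScale n)).continuous.aemeasurable).ennreal_ofReal
    _ ≤ liminf b atTop := liminf_le_liminf (Eventually.of_forall hb)
    _ = b0 := hlim.liminf_eq

theorem lintegral_profile_le_smoothMoment (σ c : ℝ) {g : V → ℝ} (hg0 : ∀ v, 0 ≤ g v) :
    ∫⁻ v, ENNReal.ofReal (g v * profile σ c (‖v‖ ^ 2)) ≤ smoothMoment σ g :=
  lintegral_mono fun v => ENNReal.ofReal_le_ofReal
    (mul_le_mul_of_nonneg_left (profile_le σ c (sq_nonneg _)) (hg0 v))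

theorem smoothMoment_zero {g : V → ℝ} (hg0 : ∀ v, 0 ≤ g v) (hgi : Integrable g) :
    smoothMoment 0 g = ENNReal.ofReal (∫ v, g v) := by
  rw [ofReal_integral_eq_lintegral_ofReal hgi (ae_of_all _ hg0)]
  simp [smoothMoment]

theorem integrable_mul_profile (σ : ℝ) {c : ℝ} (hc : 0 < c) {g : V → ℝ} (hgi : Integrable g) :
    Integrable fun v => g v * profile σ c (‖v‖ ^ 2) := by
  obtain ⟨C, hC⟩ := (contDiff_profile σ c).continuous.bounded_above_of_compact_support
    (hasCompactSupport_profile σ hc)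
  exact hgi.mul_bdd (contDiff_profile σ c).continuous.aestronglyMeasurable (ae_of_all _ hC)

theorem ofReal_integral_mul_profile (σ : ℝ) {c : ℝ} (hc : 0 < c) {g : V → ℝ}
    (hg0 : ∀ v, 0 ≤ g v) (hgi : Integrable g) :
    ENNReal.ofReal (∫ v, g v * profile σ c (‖v‖ ^ 2)) =
      ∫⁻ v, ENNReal.ofReal (g v * profile σ c (‖v‖ ^ 2)) :=
  ofReal_integral_eq_lintegral_ofReal (integrable_mul_profile σ hc hgi)
    (ae_of_all _ fun v => mul_nonneg (hg0 v) (profile_nonneg σ c (sq_nonneg _)))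

namespace IsClassicalSolution

variable {γ T : ℝ} {f : ℝ → V → ℝ}

/-- The weak inequality for a truncated radial weight. -/
theorem lintegral_profile_le (h : IsClassicalSolution γ T f) (hγ : γ ∈ Ico (-3 : ℝ) (-2))
    (σ : ℝ) {c : ℝ} (hc : 0 < c) {l : ℝ → ℝ} (hl : MonotoneOn l (Ici 0))
    (hl0 : ∀ x, 0 ≤ x → 0 ≤ l x)
    (hb : ∀ x, 0 ≤ x → 2 * |profileDeriv σ c x| + 4 * x * |profileDeriv2 σ c x| ≤ l x)
    {A B t : ℝ} (hA0 : 0 ≤ A) (ht : t ∈ Ioc 0 T)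
    (hA : ∀ τ ∈ Ioc 0 t, ∀ v, diffusionCoeff γ (f τ) v ≤ A)
    (hfL : ∀ τ ∈ Ioc 0 t, Integrable fun v => f τ v * l (‖v‖ ^ 2))
    (hB : ∀ τ ∈ Ioc 0 t, ∫ v, f τ v * l (‖v‖ ^ 2) ≤ B) :
    ∫⁻ v, ENNReal.ofReal (f t v * profile σ c (‖v‖ ^ 2)) ≤
      smoothMoment σ (f 0) + ENNReal.ofReal (5 * A * B * t) := by
  have hT : 0 ≤ T := ht.1.le.trans ht.2
  have ht' := Ioc_subset_Icc_self ht
  have h0 : (0 : ℝ) ∈ Icc 0 T := ⟨le_rfl, hT⟩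
  have key := h.integral_mul_le hγ (contDiff_profile σ c) (hasCompactSupport_profile σ hc)
    (L := fun v => l (‖v‖ ^ 2)) (fun v => hl0 _ (sq_nonneg _))
    (laplacian_radial_le (fun x hx => hasDerivAt_profile σ c hx)
      (fun x hx => hasDerivAt_profileDeriv σ c hx) hb (contDiff_profile σ c))
    (abs_fderiv_radial_sub_le (fun x hx => hasDerivAt_profile σ c hx)
      (fun x hx => hasDerivAt_profileDeriv σ c hx) hl hl0 hb) hA0 ht hA hfL hB
  rw [← ofReal_integral_mul_profile σ hc (h.nonneg t ht') (h.integrable t ht')]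
  refine (ENNReal.ofReal_le_ofReal key).trans (ENNReal.ofReal_add_le.trans ?_)
  gcongr
  rw [ofReal_integral_mul_profile σ hc (h.nonneg 0 h0) (h.integrable 0 h0)]
  exact lintegral_profile_le_smoothMoment σ c (h.nonneg 0 h0)

/-- The mass does not increase. -/
theorem integral_le_initial (h : IsClassicalSolution γ T f) (hγ : γ ∈ Ico (-3 : ℝ) (-2))
    (hK : normLinftyL3 T f < ∞) {t : ℝ} (ht : t ∈ Ioc 0 T) : ∫ v, f t v ≤ ∫ v, f 0 v := by
  obtain ⟨M, hM⟩ := h.bounded_mass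
  obtain ⟨D, hD0, hD⟩ := exists_profile_zero_bound
  have hT : 0 ≤ T := ht.1.le.trans ht.2
  have ht' := Ioc_subset_Icc_self ht
  have h0 : (0 : ℝ) ∈ Icc 0 T := ⟨le_rfl, hT⟩
  have hM0 : 0 ≤ M := (integral_nonneg (h.nonneg 0 h0)).trans (hM 0 h0)
  -- Provisional bound on a[f] from the assumed mass bound `M`. Its size is irrelevant because the
  -- error carries the factor `regScale n`; afterwards the initial mass replaces `M`.
  set A := M + (normLinftyL3 T f).toReal ^ 3 + ballConst
  have hA0 : 0 ≤ A := by
    have := ballConst_nonneg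
    positivity
  have hle : smoothMoment 0 (f t) ≤ smoothMoment 0 (f 0) := by
    refine smoothMoment_le_of_profile_le (h.continuous_slice ht).measurable.aemeasurable
      (b := fun n => smoothMoment 0 (f 0) +
        ENNReal.ofReal (5 * A * (M * (D * regScale n)) * t)) (fun n => ?_) ?_
    · have hc := regScale_pos n
      have hsub : ∀ τ ∈ Ioc 0 t, τ ∈ Ioc 0 T := fun τ hτ => ⟨hτ.1, hτ.2.trans ht.2⟩
      refine h.lintegral_profile_le hγ 0 hc (l := fun _ => D * regScale n) monotoneOn_const
        (fun _ _ => by positivity) (hD _ hc) hA0 ht (fun τ hτ v => ?_) (fun τ hτ => ?_)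
        (fun τ hτ => ?_)
      · have h1 := h.diffusionCoeff_le hγ hK (hsub τ hτ) v
        have h2 := hM τ (Ioc_subset_Icc_self (hsub τ hτ))
        simp only [A]
        linarith
      · exact (h.integrable τ (Ioc_subset_Icc_self (hsub τ hτ))).mul_const _
      · rw [integral_mul_const]
        exact mul_le_mul_of_nonneg_right (hM τ (Ioc_subset_Icc_self (hsub τ hτ))) (by positivity)
    · have h1 : Tendsto (fun n => 5 * A * (M * (D * regScale n)) * t) atTop
          (𝓝 (5 * A * (M * (D * 0)) * t)) :=
        (((tendsto_regScale.const_mul D).const_mul M).const_mul (5 * A)).mul_const t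
      have h2 := (tendsto_const_nhds (x := smoothMoment 0 (f 0))).add (ENNReal.tendsto_ofReal h1)
      simpa using h2
  rw [smoothMoment_zero (h.nonneg t ht') (h.integrable t ht'),
    smoothMoment_zero (h.nonneg 0 h0) (h.integrable 0 h0)] at hle
  exact (ENNReal.ofReal_le_ofReal_iff (integral_nonneg (h.nonneg 0 h0))).1 hle

/-- The bound on the diffusion coefficient in terms of the initial mass and the `L³` norm. -/
noncomputable def diffusionBound (m K : ℝ≥0∞) : ℝ := m.toReal + K.toReal ^ 3 + ballConst

theorem diffusionBound_nonneg (m K : ℝ≥0∞) : 0 ≤ diffusionBound m K := by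
  have := ballConst_nonneg
  unfold diffusionBound
  positivity

theorem eLpNorm_initial (h : IsClassicalSolution γ T f) (hT : 0 ≤ T) :
    eLpNorm (f 0) 1 volume = smoothMoment 0 (f 0) := by
  have h0 : (0 : ℝ) ∈ Icc 0 T := ⟨le_rfl, hT⟩
  rw [eLpNorm_one_eq_lintegral_enorm, smoothMoment]
  refine lintegral_congr fun v => ?_
  rw [Real.enorm_of_nonneg (h.nonneg 0 h0 v), Real.rpow_zero, mul_one]

theorem smoothMoment_zero_ne_top (h : IsClassicalSolution γ T f) (hT : 0 ≤ T) :
    smoothMoment 0 (f 0) ≠ ∞ := by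
  have h0 : (0 : ℝ) ∈ Icc 0 T := ⟨le_rfl, hT⟩
  rw [smoothMoment_zero (h.nonneg 0 h0) (h.integrable 0 h0)]
  exact ENNReal.ofReal_ne_top

theorem smoothMoment_zero_le (h : IsClassicalSolution γ T f) (hγ : γ ∈ Ico (-3 : ℝ) (-2))
    (hK : normLinftyL3 T f < ∞) {t : ℝ} (ht : t ∈ Icc 0 T) :
    smoothMoment 0 (f t) ≤ smoothMoment 0 (f 0) := by
  rcases ht.1.eq_or_lt with h1 | h1
  · rw [← h1]
  have h0 : (0 : ℝ) ∈ Icc 0 T := ⟨le_rfl, ht.1.trans ht.2⟩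
  rw [smoothMoment_zero (h.nonneg t ht) (h.integrable t ht),
    smoothMoment_zero (h.nonneg 0 h0) (h.integrable 0 h0)]
  exact ENNReal.ofReal_le_ofReal (h.integral_le_initial hγ hK ⟨h1, ht.2⟩)

theorem diffusionCoeff_le_bound (h : IsClassicalSolution γ T f) (hγ : γ ∈ Ico (-3 : ℝ) (-2))
    (hK : normLinftyL3 T f < ∞) {t : ℝ} (ht : t ∈ Ioc 0 T) (v : V) :
    diffusionCoeff γ (f t) v ≤
      diffusionBound (eLpNorm (f 0) 1 volume) (normLinftyL3 T f) := by
  have hT : 0 ≤ T := ht.1.le.trans ht.2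
  have h0 : (0 : ℝ) ∈ Icc 0 T := ⟨le_rfl, hT⟩
  have h1 := h.diffusionCoeff_le hγ hK ht v
  have h2 := h.integral_le_initial hγ hK ht
  rw [diffusionBound, h.eLpNorm_initial hT, smoothMoment_zero (h.nonneg 0 h0) (h.integrable 0 h0),
    ENNReal.toReal_ofReal (integral_nonneg (h.nonneg 0 h0))]
  linarith

end IsClassicalSolution

/-! ### Propagation and growth of moments -/

/-- The moment of order `σ` grows at most linearly with a rate controlled by the moment of
order `(σ - 1)₊`. -/
theorem exists_smoothMoment_step {σ : ℝ} (hσ : 0 ≤ σ) : ∃ D : ℝ≥0, ∀ (γ T : ℝ) (f : ℝ → V → ℝ),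
    γ ∈ Ico (-3 : ℝ) (-2) → IsClassicalSolution γ T f → normLinftyL3 T f < ∞ →
    ∀ t ∈ Icc 0 T, ∀ B : ℝ≥0∞, B ≠ ∞ →
    (∀ τ ∈ Icc 0 t, smoothMoment (max (σ - 1) 0) (f τ) ≤ B) →
    smoothMoment σ (f t) ≤ smoothMoment σ (f 0) +
      D * ENNReal.ofReal (IsClassicalSolution.diffusionBound
        (eLpNorm (f 0) 1 volume) (normLinftyL3 T f)) * B * ENNReal.ofReal t := by
  obtain ⟨D, hD0, hD⟩ := exists_profile_bound hσ
  refine ⟨(5 * D).toNNReal, fun γ T f hγ h hK t ht B hBt hB => ?_⟩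
  rcases ht.1.eq_or_lt with h1 | h1
  · rw [← h1]
    exact le_self_add
  have htT : t ∈ Ioc 0 T := ⟨h1, ht.2⟩
  have hsub : ∀ τ ∈ Ioc 0 t, τ ∈ Ioc 0 T := fun τ hτ => ⟨hτ.1, hτ.2.trans ht.2⟩
  set A := IsClassicalSolution.diffusionBound (eLpNorm (f 0) 1 volume) (normLinftyL3 T f)
  have hA0 : 0 ≤ A := IsClassicalSolution.diffusionBound_nonneg _ _
  set q := max (σ - 1) 0 with hq
  have hq0 : 0 ≤ q := le_max_right _ _
  have e : ENNReal.ofReal (5 * A * (D * B.toReal) * t) =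
      (5 * D).toNNReal * ENNReal.ofReal A * B * ENNReal.ofReal t := by
    rw [show 5 * A * (D * B.toReal) * t = 5 * D * A * B.toReal * t by ring,
      ENNReal.ofReal_mul (by positivity), ENNReal.ofReal_mul (by positivity),
      ENNReal.ofReal_mul (by positivity), ENNReal.ofReal_toReal hBt]
    rfl
  rw [← e]
  have hcont : Continuous fun v : V => (1 + ‖v‖ ^ 2) ^ q :=
    Continuous.rpow_const (by fun_prop) fun v => Or.inr hq0
  have hnn : ∀ τ ∈ Ioc 0 t, ∀ v, 0 ≤ f τ v * (1 + ‖v‖ ^ 2) ^ q := fun τ hτ v =>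
    mul_nonneg (h.nonneg τ (Ioc_subset_Icc_self (hsub τ hτ)) v) (by positivity)
  -- Finiteness of `B` is what turns the bound on the lower moment into integrability.
  have hint : ∀ τ ∈ Ioc 0 t, Integrable fun v => f τ v * (1 + ‖v‖ ^ 2) ^ q := fun τ hτ => by
    refine ⟨((h.continuous_slice (hsub τ hτ)).mul hcont).aestronglyMeasurable, ?_⟩
    rw [hasFiniteIntegral_iff_ofReal (ae_of_all _ (hnn τ hτ))]
    exact (hB τ (Ioc_subset_Icc_self hτ)).trans_lt hBt.lt_top
  have hle : ∀ τ ∈ Ioc 0 t, ∫ v, f τ v * (1 + ‖v‖ ^ 2) ^ q ≤ B.toReal := fun τ hτ => by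
    rw [integral_eq_lintegral_of_nonneg_ae (ae_of_all _ (hnn τ hτ))
      (hint τ hτ).aestronglyMeasurable]
    exact ENNReal.toReal_mono hBt (hB τ (Ioc_subset_Icc_self hτ))
  refine smoothMoment_le_of_profile_le (h.continuous_slice htT).measurable.aemeasurable
    (fun n => ?_) tendsto_const_nhds
  refine h.lintegral_profile_le hγ σ (regScale_pos n) (l := fun x => D * (1 + x) ^ q) ?_ ?_
    (hD _ (regScale_pos n)) hA0 htT (fun τ hτ v => h.diffusionCoeff_le_bound hγ hK (hsub τ hτ) v)
    (fun τ hτ => ?_) (fun τ hτ => ?_)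
  · intro x hx y hy hxy
    have hx' := mem_Ici.1 hx
    beta_reduce
    gcongr
  · intro x hx
    positivity
  · exact ((hint τ hτ).const_mul D).congr (ae_of_all _ fun v => by ring)
  · calc ∫ v, f τ v * (D * (1 + ‖v‖ ^ 2) ^ q) = D * ∫ v, f τ v * (1 + ‖v‖ ^ 2) ^ q := by
          rw [← integral_const_mul]
          exact integral_congr_ae (ae_of_all _ fun v => by ring)
      _ ≤ D * B.toReal := by
          gcongr
          exact hle τ hτ

theorem rpow_le_mul_add {σ : ℝ} (hσ : 0 ≤ σ) (hσ1 : σ ≤ 1) {Λ y : ℝ} (hΛ : 0 < Λ) (hy : 0 < y) :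
    y ^ σ ≤ Λ ^ (σ - 1) * y + Λ ^ σ := by
  rcases le_total y Λ with h | h
  · have h1 : y ^ σ ≤ Λ ^ σ := Real.rpow_le_rpow hy.le h hσ
    have : 0 ≤ Λ ^ (σ - 1) * y := by positivity
    linarith
  · have h1 : y ^ (σ - 1) ≤ Λ ^ (σ - 1) := Real.rpow_le_rpow_of_nonpos hΛ h (by linarith)
    have h2 : y ^ σ = y ^ (σ - 1) * y := by
      rw [← Real.rpow_add_one hy.ne']; congr 1; ring
    have h3 : 0 ≤ Λ ^ σ := by positivity
    rw [h2]
    nlinarith [mul_le_mul_of_nonneg_right h1 hy.le]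

/-- The weight is split at 1+|v|² = Λ. With Λ of the order of the time, linear growth of the first
moment becomes growth Λ^σ. -/
theorem smoothMoment_interpolate {σ : ℝ} (hσ : 0 ≤ σ) (hσ1 : σ ≤ 1) {Λ : ℝ} (hΛ : 0 < Λ)
    {g : V → ℝ} (hg : AEMeasurable g) (hg0 : ∀ v, 0 ≤ g v) :
    smoothMoment σ g ≤ ENNReal.ofReal (Λ ^ (σ - 1)) * smoothMoment 1 g +
      ENNReal.ofReal (Λ ^ σ) * smoothMoment 0 g := by
  have m0 : AEMeasurable fun v => ENNReal.ofReal (g v * (1 + ‖v‖ ^ 2) ^ (0 : ℝ)) := by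
    simpa using hg.ennreal_ofReal
  unfold smoothMoment
  rw [← lintegral_const_mul' _ _ ENNReal.ofReal_ne_top,
    ← lintegral_const_mul' _ _ ENNReal.ofReal_ne_top,
    ← lintegral_add_right' _ (m0.const_mul _)]
  refine lintegral_mono fun v => ?_
  rw [← ENNReal.ofReal_mul (by positivity), ← ENNReal.ofReal_mul (by positivity),
    ← ENNReal.ofReal_add]
  · refine ENNReal.ofReal_le_ofReal ?_
    have := mul_le_mul_of_nonneg_left
      (rpow_le_mul_add hσ hσ1 hΛ (by positivity : 0 < 1 + ‖v‖ ^ 2)) (hg0 v)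
    rw [Real.rpow_one, Real.rpow_zero]
    linarith
  · have := hg0 v
    positivity
  · have := hg0 v
    positivity

theorem smoothMoment_mono {σ τ : ℝ} (h : σ ≤ τ) {g : V → ℝ} (hg0 : ∀ v, 0 ≤ g v) :
    smoothMoment σ g ≤ smoothMoment τ g :=
  lintegral_mono fun v => ENNReal.ofReal_le_ofReal (mul_le_mul_of_nonneg_left
    (Real.rpow_le_rpow_of_exponent_le (by nlinarith [sq_nonneg ‖v‖]) h) (hg0 v))

theorem ofReal_mul_rpow_sub_one {Λ : ℝ} (hΛ : 0 < Λ) (q : ℝ) :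
    ENNReal.ofReal Λ * ENNReal.ofReal (Λ ^ (q - 1)) = ENNReal.ofReal (Λ ^ q) := by
  rw [← ENNReal.ofReal_mul hΛ.le, mul_comm, ← Real.rpow_add_one hΛ.ne']
  ring_nf

/-- Growth of the smooth moments, uniformly on `[0, Λ]`. -/
theorem exists_smoothMoment_growth (k : ℕ) : ∀ σ : ℝ, 0 ≤ σ → σ ≤ k + 1 → ∀ A : ℝ,
    ∃ C : ℝ≥0, 1 ≤ C ∧ ∀ (γ T : ℝ) (f : ℝ → V → ℝ),
      γ ∈ Ico (-3 : ℝ) (-2) → IsClassicalSolution γ T f → normLinftyL3 T f < ∞ →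
      IsClassicalSolution.diffusionBound (eLpNorm (f 0) 1 volume) (normLinftyL3 T f) = A →
      ∀ Λ : ℝ, 1 ≤ Λ → ∀ t ∈ Icc 0 T, t ≤ Λ →
        smoothMoment σ (f t) ≤ C * (smoothMoment (max σ 1) (f 0) * ENNReal.ofReal (Λ ^ (σ - 1)) +
          smoothMoment 0 (f 0) * ENNReal.ofReal (Λ ^ σ)) := by
  have base : ∀ σ : ℝ, 0 ≤ σ → σ ≤ 1 → ∀ A : ℝ,
    ∃ C : ℝ≥0, 1 ≤ C ∧ ∀ (γ T : ℝ) (f : ℝ → V → ℝ),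
      γ ∈ Ico (-3 : ℝ) (-2) → IsClassicalSolution γ T f → normLinftyL3 T f < ∞ →
      IsClassicalSolution.diffusionBound (eLpNorm (f 0) 1 volume) (normLinftyL3 T f) = A →
      ∀ Λ : ℝ, 1 ≤ Λ → ∀ t ∈ Icc 0 T, t ≤ Λ →
        smoothMoment σ (f t) ≤ C * (smoothMoment (max σ 1) (f 0) * ENNReal.ofReal (Λ ^ (σ - 1)) +
          smoothMoment 0 (f 0) * ENNReal.ofReal (Λ ^ σ)) := by
    intro σ hσ hσ1 A
    obtain ⟨D, hD⟩ := exists_smoothMoment_step (σ := 1) zero_le_one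
    refine ⟨1 + D * A.toNNReal, le_self_add, fun γ T f hγ h hK hA Λ hΛ t ht htΛ => ?_⟩
    have hT := ht.1.trans ht.2
    have hΛ0 : 0 < Λ := by linarith
    have hmeas : AEMeasurable (f t) := (h.integrable t ht).aemeasurable
    have h1 := smoothMoment_interpolate hσ hσ1 hΛ0 hmeas (h.nonneg t ht)
    have h2 := hD γ T f hγ h hK t ht (smoothMoment 0 (f 0)) (h.smoothMoment_zero_ne_top hT)
      (fun τ hτ => by
        rw [sub_self, max_self]
        exact h.smoothMoment_zero_le hγ hK ⟨hτ.1, hτ.2.trans ht.2⟩)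
    have h3 := h.smoothMoment_zero_le hγ hK ht
    rw [hA] at h2
    rw [max_eq_right hσ1]
    set J := smoothMoment 1 (f 0)
    set m := smoothMoment 0 (f 0)
    set a := ENNReal.ofReal A
    have ea : ((A.toNNReal : ℝ≥0) : ℝ≥0∞) = a := rfl
    have htl : ENNReal.ofReal t ≤ ENNReal.ofReal Λ := ENNReal.ofReal_le_ofReal htΛ
    have er := ofReal_mul_rpow_sub_one hΛ0 σ
    set P := ENNReal.ofReal (Λ ^ (σ - 1))
    set Q := ENNReal.ofReal (Λ ^ σ)
    calc smoothMoment σ (f t) ≤ P * (J + D * a * m * ENNReal.ofReal Λ) + Q * m := by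
          refine h1.trans (add_le_add ?_ ?_)
          · gcongr
            exact h2.trans (by gcongr)
          · gcongr
      _ = P * J + D * a * m * (ENNReal.ofReal Λ * P) + Q * m := by ring
      _ = J * P + D * a * (m * Q) + m * Q := by rw [er]; ring
      -- The missing cross term is added so that the constant factors out.
      _ ≤ J * P + D * a * (m * Q) + m * Q + D * a * (J * P) := le_self_add
      _ = _ := by
          push_cast
          rw [ea]
          ring
  induction k with
  | zero =>
    intro σ hσ hσ1 A
    exact base σ hσ (by simpa using hσ1) A
  | succ k ih =>
    intro σ hσ hσk A
    rcases le_total σ 1 with hσ1 | hσ1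
    · exact base σ hσ hσ1 A
    obtain ⟨C', hC1, hC'⟩ := ih (σ - 1) (by linarith) (by push_cast at hσk; linarith) A
    obtain ⟨D, hD⟩ := exists_smoothMoment_step hσ
    refine ⟨1 + D * A.toNNReal * C', le_self_add, fun γ T f hγ h hK hA Λ hΛ t ht htΛ => ?_⟩
    have hT := ht.1.trans ht.2
    have h0 : (0 : ℝ) ∈ Icc 0 T := ⟨le_rfl, hT⟩
    have hΛ0 : 0 < Λ := by linarith
    rw [max_eq_left hσ1]
    have hP1 : 1 ≤ ENNReal.ofReal (Λ ^ (σ - 1)) := by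
      rw [← ENNReal.ofReal_one]
      exact ENNReal.ofReal_le_ofReal (Real.one_le_rpow hΛ (by linarith))
    -- With an infinite initial moment the right-hand side is infinite, its coefficients being
    -- nonzero; otherwise the bound on the lower moment is finite, as the linear step demands.
    by_cases hJ : smoothMoment σ (f 0) = ∞
    · have hne : ENNReal.ofReal (Λ ^ (σ - 1)) ≠ 0 := (zero_lt_one.trans_le hP1).ne'
      rw [hJ, ENNReal.top_mul hne, top_add, ENNReal.mul_top]
      · exact le_top
      · positivity
    have hmax : max (σ - 1) 0 = σ - 1 := max_eq_left (by linarith)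
    have hJ' : smoothMoment (max (σ - 1) 1) (f 0) ≤ smoothMoment σ (f 0) :=
      smoothMoment_mono (max_le (by linarith) hσ1) (h.nonneg 0 h0)
    have hm := h.smoothMoment_zero_ne_top hT
    have hprev : ∀ τ ∈ Icc 0 t, smoothMoment (max (σ - 1) 0) (f τ) ≤
        C' * (smoothMoment σ (f 0) * ENNReal.ofReal (Λ ^ (σ - 1 - 1)) +
          smoothMoment 0 (f 0) * ENNReal.ofReal (Λ ^ (σ - 1))) := by
      intro τ hτ
      rw [hmax]
      -- The same Λ serves all τ ≤ t. The rate is thus a constant, and multiplying it by t ≤ Λ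
      -- raises each power of Λ by one without integrating in time.
      refine (hC' γ T f hγ h hK hA Λ hΛ τ ⟨hτ.1, hτ.2.trans ht.2⟩ (hτ.2.trans htΛ)).trans ?_
      gcongr
    have h2 := hD γ T f hγ h hK t ht _ (ENNReal.mul_ne_top ENNReal.coe_ne_top
      (ENNReal.add_ne_top.2 ⟨ENNReal.mul_ne_top hJ ENNReal.ofReal_ne_top,
        ENNReal.mul_ne_top hm ENNReal.ofReal_ne_top⟩)) hprev
    rw [hA] at h2
    have er := ofReal_mul_rpow_sub_one hΛ0 σ
    have er2 := ofReal_mul_rpow_sub_one hΛ0 (σ - 1)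
    set J := smoothMoment σ (f 0)
    set m := smoothMoment 0 (f 0)
    set a := ENNReal.ofReal A
    have ea : ((A.toNNReal : ℝ≥0) : ℝ≥0∞) = a := rfl
    have htl : ENNReal.ofReal t ≤ ENNReal.ofReal Λ := ENNReal.ofReal_le_ofReal htΛ
    set P := ENNReal.ofReal (Λ ^ (σ - 1))
    set P' := ENNReal.ofReal (Λ ^ (σ - 1 - 1))
    set Q := ENNReal.ofReal (Λ ^ σ)
    calc smoothMoment σ (f t) ≤ J * P + D * a * (C' * (J * P' + m * P)) * ENNReal.ofReal Λ := by
          refine h2.trans (add_le_add (le_mul_of_one_le_right zero_le hP1) ?_)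
          gcongr
      _ = J * P + D * a * C' * (J * (ENNReal.ofReal Λ * P') + m * (ENNReal.ofReal Λ * P)) := by
          ring
      _ = J * P + D * a * C' * (J * P + m * Q) := by rw [er, er2]
      _ ≤ J * P + D * a * C' * (J * P + m * Q) + m * Q := le_self_add
      _ = _ := by
          push_cast
          rw [ea]
          ring

/-! ### Comparison with the moments, nonconcentration, conclusion -/

theorem norm_rpow_eq (s : ℝ) (v : V) : ‖v‖ ^ s = (‖v‖ ^ 2) ^ (s / 2) := (rpow_norm_sq s).symm

theorem moment_le_smoothMoment {s : ℝ} (hs : 0 ≤ s) {g : V → ℝ} (hg0 : ∀ v, 0 ≤ g v) :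
    moment s g ≤ smoothMoment (s / 2) g := by
  refine lintegral_mono fun v => ENNReal.ofReal_le_ofReal (mul_le_mul_of_nonneg_left ?_ (hg0 v))
  rw [norm_rpow_eq]
  exact Real.rpow_le_rpow (by positivity) (by linarith) (by linarith)

theorem smoothMoment_le_moment {s : ℝ} (hs : 0 ≤ s) {g : V → ℝ} (hg : AEMeasurable g)
    (hg0 : ∀ v, 0 ≤ g v) :
    smoothMoment (s / 2) g ≤ ENNReal.ofReal (2 ^ (s / 2)) * (smoothMoment 0 g + moment s g) := by
  have m0 : AEMeasurable fun v => ENNReal.ofReal (g v * (1 + ‖v‖ ^ 2) ^ (0 : ℝ)) := by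
    simpa using hg.ennreal_ofReal
  unfold smoothMoment moment
  rw [← lintegral_add_left' m0, ← lintegral_const_mul' _ _ ENNReal.ofReal_ne_top]
  refine lintegral_mono fun v => ?_
  have hgv := hg0 v
  rw [← ENNReal.ofReal_add (by positivity) (by positivity), ← ENNReal.ofReal_mul (by positivity)]
  refine ENNReal.ofReal_le_ofReal ?_
  rw [Real.rpow_zero, norm_rpow_eq, ← mul_add, mul_left_comm]
  refine mul_le_mul_of_nonneg_left ?_ hgv
  set x := ‖v‖ ^ 2 with hx
  have hx0 : 0 ≤ x := sq_nonneg _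
  have hs2 : 0 ≤ s / 2 := by linarith
  have h2 : (0 : ℝ) ≤ 2 ^ (s / 2) := by positivity
  have h3 : 0 ≤ x ^ (s / 2) := by positivity
  rcases le_total x 1 with h | h
  · have : (1 + x) ^ (s / 2) ≤ 2 ^ (s / 2) := Real.rpow_le_rpow (by positivity) (by linarith) hs2
    nlinarith
  · have : (1 + x) ^ (s / 2) ≤ (2 * x) ^ (s / 2) :=
      Real.rpow_le_rpow (by positivity) (by linarith) hs2
    rw [Real.mul_rpow (by norm_num) hx0] at this
    nlinarith

/-- A mass that is bounded in `L³` cannot concentrate at the origin, so that it is controlled by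
its moments. -/
theorem exists_mass_le_moment {m K : ℝ≥0∞} (hm : m ≠ ∞) {r : ℝ} (hr : 0 ≤ r) :
    ∃ D : ℝ≥0, ∀ (γ T : ℝ) (f : ℝ → V → ℝ), 0 < T → IsClassicalSolution γ T f →
      normLinftyL3 T f = K → normLinftyL3 T f < ∞ → smoothMoment 0 (f 0) = m →
      m ≤ D * moment r (f 0) := by
  rcases eq_or_ne m 0 with hm0 | hm0
  · exact ⟨0, fun _ _ _ _ _ _ _ _ => by simp [hm0]⟩
  set M := m.toReal with hM
  have hMpos : 0 < M := ENNReal.toReal_pos hm0 hm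
  set k := K.toReal ^ 3 with hk
  have hk0 : 0 ≤ k := by positivity
  -- Height of truncation: where f > lam, f ≤ f³/lam², and that part has mass at most k/lam² ≤ M/4.
  -- The radius δ chosen next makes the part below lam in the ball of radius 2δ also at most M/4.
  set lam := 1 + 4 * k / M with hlam
  have hlam1 : 1 ≤ lam := by
    have : 0 ≤ 4 * k / M := by positivity
    linarith
  have hkl : k / lam ^ 2 ≤ M / 4 := by
    rw [div_le_iff₀ (by positivity)]
    have h1 : lam * M = M + 4 * k := by rw [hlam]; field_simp
    nlinarith
  obtain ⟨δ, hδ0, hδ⟩ : ∃ δ : ℝ, 0 < δ ∧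
      lam * (volume : Measure V).real (Metric.closedBall 0 (2 * δ)) ≤ M / 4 := by
    have hv : ∀ δ : ℝ, 0 < δ → (volume : Measure V).real (Metric.closedBall 0 (2 * δ)) =
        (2 * δ) ^ 3 * (volume : Measure V).real (Metric.ball 0 1) := fun δ hδ => by
      have := Measure.addHaar_real_closedBall (volume : Measure V) 0 (r := 2 * δ) (by positivity)
      simpa using this
    have ht : Tendsto (fun δ : ℝ =>
        lam * ((2 * δ) ^ 3 * (volume : Measure V).real (Metric.ball 0 1))) (𝓝[>] 0) (𝓝 0) := by
      have : Tendsto (fun δ : ℝ =>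
        lam * ((2 * δ) ^ 3 * (volume : Measure V).real (Metric.ball 0 1))) (𝓝 0)
          (𝓝 (lam * ((2 * 0) ^ 3 * (volume : Measure V).real (Metric.ball 0 1)))) :=
        Continuous.tendsto (by fun_prop) 0
      simp only [mul_zero, ne_eq, OfNat.ofNat_ne_zero, not_false_eq_true, zero_pow, zero_mul]
        at this
      exact this.mono_left nhdsWithin_le_nhds
    have h1 := ht.eventually (ge_mem_nhds (by positivity : 0 < M / 4))
    obtain ⟨δ, h2, h3⟩ := (h1.and self_mem_nhdsWithin).exists
    exact ⟨δ, h3, by rw [hv δ h3]; exact h2⟩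
  refine ⟨(2 * (δ ^ r)⁻¹).toNNReal, fun γ T f hT h hKf hKt hmf => ?_⟩
  have h0 : (0 : ℝ) ∈ Icc 0 T := ⟨le_rfl, hT.le⟩
  set ψ : V → ℝ := fun v => cutoff (‖v‖ ^ 2 / δ ^ 2) with hψ
  have hψc : Continuous ψ := (contDiff_cutoff (n := 0)).continuous.comp (by fun_prop)
  have hψ0 : ∀ v, 2 * δ < ‖v‖ → ψ v = 0 := fun v hv => by
    refine cutoff_of_ge ?_
    rw [le_div_iff₀ (by positivity)]
    nlinarith
  have hψs : HasCompactSupport ψ := HasCompactSupport.intro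
    (isCompact_closedBall (0 : V) (2 * δ)) fun v hv => hψ0 v (by simpa using hv)
  have hle : ∀ t ∈ Ioc 0 T, ∫ v, f t v * ψ v ≤ M / 2 := by
    intro t ht
    have htI := Ioc_subset_Icc_self ht
    obtain ⟨hc3, hle3⟩ := h.integrable_cube hKt ht
    rw [hKf] at hle3
    have hball : Integrable ((Metric.closedBall (0 : V) (2 * δ)).indicator fun _ => lam) := by
      rw [integrable_indicator_iff measurableSet_closedBall]
      exact integrableOn_const (isCompact_closedBall _ _).measure_ne_top
    have hi : Integrable fun v => f t v * ψ v :=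
      ((h.continuous_slice ht).mul hψc).integrable_of_hasCompactSupport hψs.mul_left
    calc ∫ v, f t v * ψ v
        ≤ ∫ v, ((Metric.closedBall (0 : V) (2 * δ)).indicator (fun _ => lam) v +
            f t v ^ 3 / lam ^ 2) := by
          refine integral_mono hi (hball.add (hc3.div_const _)) fun v => ?_
          have hf0 := h.nonneg t htI v
          have hq : 0 ≤ f t v ^ 3 / lam ^ 2 := by positivity
          beta_reduce
          by_cases hv : v ∈ Metric.closedBall (0 : V) (2 * δ)
          · rw [indicator_of_mem hv]
            have h1 : f t v * ψ v ≤ f t v := mul_le_of_le_one_right hf0 (cutoff_le_one _)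
            rcases le_total (f t v) lam with h2 | h2
            · linarith
            · have : f t v ≤ f t v ^ 3 / lam ^ 2 := by
                rw [le_div_iff₀ (by positivity)]
                have : lam ^ 2 ≤ f t v ^ 2 := by gcongr
                nlinarith
              linarith
          · rw [indicator_of_notMem hv, hψ0 v (by simpa using hv), mul_zero, zero_add]
            exact hq
      _ = (volume : Measure V).real (Metric.closedBall 0 (2 * δ)) * lam +
            (∫ v, f t v ^ 3) / lam ^ 2 := by
          rw [integral_add hball (hc3.div_const _), integral_div,
            integral_indicator measurableSet_closedBall, setIntegral_const, smul_eq_mul]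
      _ ≤ M / 4 + k / lam ^ 2 := by
          gcongr
          rw [mul_comm]
          exact hδ
      _ ≤ M / 2 := by linarith
  -- The L³ norm is an essential supremum in time and says nothing directly about f(0); the bound
  -- comes from positive times by weak convergence against ψ. So at least half of the initial mass
  -- lies outside the ball of radius δ.
  have hlim : ∫ v, f 0 v * ψ v ≤ M / 2 := by
    refine le_of_tendsto (h.initial ψ hψc hψs) ?_
    filter_upwards [Ioo_mem_nhdsGT hT] with t ht using hle t ⟨ht.1, ht.2.le⟩
  have hfi := h.integrable 0 h0
  have hf0 := h.nonneg 0 h0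
  have hψb : ∀ v, ‖ψ v‖ ≤ 1 := fun v => by
    rw [Real.norm_of_nonneg (cutoff_nonneg _)]; exact cutoff_le_one _
  have hiψ : Integrable fun v => f 0 v * ψ v :=
    hfi.mul_bdd hψc.aestronglyMeasurable (ae_of_all _ hψb)
  have hmass : M = ∫ v, f 0 v := by
    rw [hM, ← hmf, smoothMoment_zero hf0 hfi, ENNReal.toReal_ofReal (integral_nonneg hf0)]
  have hdiff : M / 2 ≤ ∫ v, (f 0 v - f 0 v * ψ v) := by
    rw [integral_sub hfi hiψ, ← hmass]
    linarith
  have hnn : ∀ v, 0 ≤ f 0 v - f 0 v * ψ v := fun v =>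
    sub_nonneg.2 (mul_le_of_le_one_right (hf0 v) (cutoff_le_one _))
  have hδr : 0 < δ ^ r := Real.rpow_pos_of_pos hδ0 r
  have hhalf : ENNReal.ofReal (M / 2) ≤ ENNReal.ofReal ((δ ^ r)⁻¹) * moment r (f 0) := by
    refine (ENNReal.ofReal_le_ofReal hdiff).trans ?_
    have hsub : Integrable fun v => f 0 v - f 0 v * ψ v := hfi.sub hiψ
    rw [ofReal_integral_eq_lintegral_ofReal hsub (ae_of_all _ hnn), moment,
      ← lintegral_const_mul' _ _ ENNReal.ofReal_ne_top]
    refine lintegral_mono fun v => ?_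
    rw [← ENNReal.ofReal_mul (by positivity)]
    refine ENNReal.ofReal_le_ofReal ?_
    have hfv := hf0 v
    rcases le_or_gt ‖v‖ δ with hv | hv
    · have : ψ v = 1 := by
        refine cutoff_of_le ?_
        rw [div_le_one (by positivity)]
        gcongr
      rw [this, mul_one, sub_self]
      positivity
    · have h1 : δ ^ r ≤ ‖v‖ ^ r := Real.rpow_le_rpow hδ0.le hv.le hr
      have h2 : 1 ≤ (δ ^ r)⁻¹ * ‖v‖ ^ r := by
        rw [inv_mul_eq_div, one_le_div hδr]
        exact h1
      have h3 : 0 ≤ f 0 v * ψ v := mul_nonneg hfv (cutoff_nonneg _)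
      nlinarith
  calc m = ENNReal.ofReal (2 * (M / 2)) := by
        rw [mul_div_cancel₀ _ (by norm_num : (2 : ℝ) ≠ 0), hM, ENNReal.ofReal_toReal hm]
    _ = ENNReal.ofReal 2 * ENNReal.ofReal (M / 2) := ENNReal.ofReal_mul (by norm_num)
    _ ≤ ENNReal.ofReal 2 * (ENNReal.ofReal ((δ ^ r)⁻¹) * moment r (f 0)) := by gcongr
    _ = ENNReal.ofReal (2 * (δ ^ r)⁻¹) * moment r (f 0) := by
        rw [← mul_assoc, ← ENNReal.ofReal_mul (by norm_num)]
    _ = _ := rfl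

/-- The growth estimate is applied with σ = s/2 and Λ = max(1,t). Then Λ^(s/2) ≤ 1 + t^(s/2), and
the mass multiplying the 1 is absorbed by the initial moment. The constant precedes γ in the
quantifiers, so it is even uniform in γ. -/
theorem exists_moment_growth_const {s : ℝ} (hs : 0 ≤ s) (m K : ℝ≥0∞) :
    ∃ C : ℝ≥0, 0 < C ∧ ∀ (γ T : ℝ) (f : ℝ → V → ℝ), γ ∈ Ico (-3 : ℝ) (-2) → 0 < T →
      IsClassicalSolution γ T f → normLinftyL3 T f < ∞ → eLpNorm (f 0) 1 volume = m →
      normLinftyL3 T f = K → ∀ t ∈ Icc 0 T,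
        moment s (f t) ≤ C * (moment (max s 2) (f 0) *
          ENNReal.ofReal (max 1 t ^ (max (s - 2) 0 / 2)) + ENNReal.ofReal (t ^ (s / 2))) := by
  rcases eq_or_ne m ∞ with hm | hm
  · refine ⟨1, one_pos, fun γ T f _ hT h _ hmf _ => ?_⟩
    rw [h.eLpNorm_initial hT.le] at hmf
    exact absurd (hmf.trans hm) (h.smoothMoment_zero_ne_top hT.le)
  have hs2 : 0 ≤ s / 2 := by linarith
  have hr : 0 ≤ max s 2 := le_max_of_le_left hs
  obtain ⟨k, hk⟩ := exists_nat_ge (s / 2)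
  obtain ⟨C, hC1, hC⟩ := exists_smoothMoment_growth k (s / 2) hs2 (by linarith)
    (IsClassicalSolution.diffusionBound m K)
  obtain ⟨D, hD⟩ := exists_mass_le_moment (K := K) hm hr
  set N : ℝ≥0 := ((2 : ℝ) ^ (max s 2 / 2)).toNNReal with hN
  refine ⟨C * (N * (D + 1) + D + m.toNNReal + 1), by positivity,
    fun γ T f hγ hT h hK hmf hKf t ht => ?_⟩
  have h0 : (0 : ℝ) ∈ Icc 0 T := ⟨le_rfl, hT.le⟩
  have hmf' : smoothMoment 0 (f 0) = m := by rw [← h.eLpNorm_initial hT.le, hmf]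
  set Λ := max 1 t with hΛ
  have hΛ1 : 1 ≤ Λ := le_max_left _ _
  have h1 := hC γ T f hγ h hK (by rw [hmf, hKf]) Λ hΛ1 t ht (le_max_right _ _)
  have h2 := hD γ T f hT h hKf hK hmf'
  have h3 := smoothMoment_le_moment hr (h.integrable 0 h0).aemeasurable (h.nonneg 0 h0)
  have hmax : max (s / 2) 1 = max s 2 / 2 := by
    rw [← max_div_div_right (by norm_num : (0 : ℝ) ≤ 2) s 2, div_self (by norm_num : (2 : ℝ) ≠ 0)]
  rw [hmf', hmax] at h1
  rw [hmf'] at h3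
  set E := moment (max s 2) (f 0)
  set P := ENNReal.ofReal (Λ ^ (max (s - 2) 0 / 2)) with hP
  set Q := ENNReal.ofReal (t ^ (s / 2)) with hQ
  have hP1 : 1 ≤ P := by
    rw [← ENNReal.ofReal_one]
    exact ENNReal.ofReal_le_ofReal (Real.one_le_rpow hΛ1 (by positivity))
  have hP2 : ENNReal.ofReal (Λ ^ (s / 2 - 1)) ≤ P :=
    ENNReal.ofReal_le_ofReal (Real.rpow_le_rpow_of_exponent_le hΛ1
      (by linarith [le_max_left (s - 2) 0]))
  have hQ2 : ENNReal.ofReal (Λ ^ (s / 2)) ≤ 1 + Q := by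
    rw [hQ, ← ENNReal.ofReal_one, ← ENNReal.ofReal_add zero_le_one (Real.rpow_nonneg ht.1 _)]
    refine ENNReal.ofReal_le_ofReal ?_
    have := Real.rpow_nonneg ht.1 (s / 2)
    rcases max_choice 1 t with e | e
    · rw [hΛ, e, Real.one_rpow]
      linarith
    · rw [hΛ, e]
      linarith
  have hmE : ((m.toNNReal : ℝ≥0) : ℝ≥0∞) = m := ENNReal.coe_toNNReal hm
  have hNE : ((N : ℝ≥0) : ℝ≥0∞) = ENNReal.ofReal (2 ^ (max s 2 / 2)) := rfl
  rw [← hNE] at h3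
  calc moment s (f t) ≤ smoothMoment (s / 2) (f t) := moment_le_smoothMoment hs (h.nonneg t ht)
    _ ≤ C * ((N * (D * E + E)) * P + m * (1 + Q)) := by
        refine h1.trans ?_
        gcongr
        exact h3.trans (by gcongr)
    _ ≤ C * ((N * (D * E + E)) * P + (D * E * P + m * Q)) := by
        gcongr
        rw [mul_add, mul_one]
        gcongr
        exact h2.trans (le_mul_of_one_le_right zero_le hP1)
    -- Adding the remaining cross terms makes the sum a multiple of EP + Q, which explains the
    -- chosen constant.
    _ ≤ C * ((N * (D * E + E)) * P + (D * E * P + m * Q)) +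
        C * ((m + 1) * (E * P) + (N * (D + 1) + D + 1) * Q) := le_self_add
    _ = _ := by
        push_cast
        rw [hmE]
        ring

theorem exists_moment_bound {γ s T : ℝ} (hγ : γ ∈ Ico (-3 : ℝ) (-2)) (hs : 0 ≤ s) (hT : 0 < T)
    {f : ℝ → V → ℝ} (h : IsClassicalSolution γ T f) (hK : normLinftyL3 T f < ∞)
    (hE : moment s (f 0) < ∞) : ∃ B : ℝ≥0, ∀ t ∈ Icc 0 T, moment s (f t) ≤ B := by
  suffices ∃ B : ℝ≥0∞, B ≠ ∞ ∧ ∀ t ∈ Icc 0 T, moment s (f t) ≤ B by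
    obtain ⟨B, hB, hle⟩ := this
    exact ⟨B.toNNReal, fun t ht => (hle t ht).trans_eq (ENNReal.coe_toNNReal hB).symm⟩
  have hs2 : 0 ≤ s / 2 := by linarith
  have h0 : (0 : ℝ) ∈ Icc 0 T := ⟨le_rfl, hT.le⟩
  have hm := h.smoothMoment_zero_ne_top hT.le
  have hJ : smoothMoment (s / 2) (f 0) ≠ ∞ :=
    ne_top_of_le_ne_top (ENNReal.mul_ne_top ENNReal.ofReal_ne_top
      (ENNReal.add_ne_top.2 ⟨hm, hE.ne⟩))
      (smoothMoment_le_moment hs (h.integrable 0 h0).aemeasurable (h.nonneg 0 h0))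
  rcases le_total (s / 2) 1 with hs1 | hs1
  -- For s ≤ 2 the growth estimate would involve the second moment, possibly infinite. A single step
  -- of order s/2 needs only the mass and the moment itself.
  · obtain ⟨D, hD⟩ := exists_smoothMoment_step hs2
    refine ⟨_, ?_, fun t ht => (moment_le_smoothMoment hs (h.nonneg t ht)).trans
      ((hD γ T f hγ h hK t ht (smoothMoment 0 (f 0)) hm fun τ hτ => ?_).trans
        (add_le_add_right (mul_le_mul_right (ENNReal.ofReal_le_ofReal ht.2) _) _))⟩
    · finiteness
    · rw [max_eq_right (by linarith)]
      exact h.smoothMoment_zero_le hγ hK ⟨hτ.1, hτ.2.trans ht.2⟩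
  · obtain ⟨k, hk⟩ := exists_nat_ge (s / 2)
    obtain ⟨C, -, hC⟩ := exists_smoothMoment_growth k (s / 2) hs2 (by linarith)
      (IsClassicalSolution.diffusionBound (eLpNorm (f 0) 1 volume) (normLinftyL3 T f))
    refine ⟨_, ?_, fun t ht => (moment_le_smoothMoment hs (h.nonneg t ht)).trans
      (hC γ T f hγ h hK rfl (max 1 T) (le_max_left _ _) t ht (ht.2.trans (le_max_right _ _)))⟩
    rw [max_eq_left hs1]
    finiteness

end KriegerStrain

theorem mainTheorem7 (γ : ℝ) (hγ : γ ∈ Set.Ico (-3 : ℝ) (-2)) (s : ℝ) (hs : 0 ≤ s) :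
    ∃ C : ℝ≥0∞ → ℝ≥0∞ → ℝ≥0, (∀ m K, 0 < C m K) ∧
      ∀ (T : ℝ), 0 < T → ∀ f : ℝ → KriegerStrain.V → ℝ,
        KriegerStrain.IsClassicalSolution γ T f →
        KriegerStrain.normLinftyL3 T f < ∞ →
        KriegerStrain.moment s (f 0) < ∞ →
        (∀ t ∈ Set.Icc (0 : ℝ) T,
          KriegerStrain.moment s (f t) ≤
            (C (eLpNorm (f 0) 1 volume) (KriegerStrain.normLinftyL3 T f) : ℝ≥0∞) *
              (KriegerStrain.moment (max s 2) (f 0) *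
                  ENNReal.ofReal (max 1 t ^ (max (s - 2) 0 / 2)) +
                ENNReal.ofReal (t ^ (s / 2)))) ∧
        (2 ≤ s → ∀ t ∈ Set.Icc (0 : ℝ) T,
          KriegerStrain.moment s (f t) ≤
            (C (eLpNorm (f 0) 1 volume) (KriegerStrain.normLinftyL3 T f) : ℝ≥0∞) *
              (KriegerStrain.moment s (f 0) * ENNReal.ofReal (max 1 t ^ ((s - 2) / 2)) +
                ENNReal.ofReal (t ^ (s / 2)))) ∧
        (∃ B : ℝ≥0, ∀ t ∈ Set.Icc (0 : ℝ) T, KriegerStrain.moment s (f t) ≤ B) := by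
  choose C hC0 hC using KriegerStrain.exists_moment_growth_const hs
  refine ⟨C, hC0, fun T hT f h hK hE => ?_⟩
  have key := hC _ _ γ T f hγ hT h hK rfl rfl
  refine ⟨key, fun hs2 => ?_, KriegerStrain.exists_moment_bound hγ hs hT h hK hE⟩
  rwa [max_eq_left hs2, max_eq_left (by linarith)] at key
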